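/- Let $\mathbb T=\mathbb R/\mathbb Z$ be the unit circle with Lebesgue measure and let all functions be real valued. For a measurable $u:\mathbb T\to\mathbb R$ let $S_u$ be the set of points at which $u$ has no approximate limit in $\mathbb R\cup\{\infty\}$. A function $u\in BV(\mathbb T)$ belongs to $SBV(\mathbb T)$ if the restriction to $\mathbb T\setminus S_u$ of the singular part of its distributional derivative $Du$ vanishes; $GSBV(\mathbb T)$ is the set of Borel functions $u$ with $\min(k,\max(u,-k))\in SBV(\mathbb T)$ for all $k\in\mathbb N$. For $u\in BV(\mathbb T)$ let $\nabla u$ be the density of the absolutely continuous part of $Du$; for $u\in GSBV(\mathbb T)$ the approximate gradient $\nabla u$ is given by $\nabla u=\nabla\min(k,\max(u,-k))$ a.e. on $\{|u|<k\}$, $k\in\mathbb N$. Put $$MS(u,v)=\int_{\mathbb T}|\nabla u|^2\,dt+\sharp(S_u)\quad\text{if } u\in GSBV(\mathbb T)\text{ and } v=1 \text{ a.e.},$$ and $MS(u,v)=\infty$ otherwise. For $r\in\mathbb R$ let $\|u\|_{H^{r}}^2=\sum_{k\in\mathbb Z}(1+4\pi^2k^2)^{r}|\hat u(k)|^2$.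 **Theorem.** Let $A$ be a linear operator that is bounded $L^1(\mathbb T)\to L^1(\mathbb T)$ and $L^2(\mathbb T)\to L^2(\mathbb T)$, and suppose that for some $s<\frac12$ and some constant $C>0$ $$\|u\|_{H^{-s}}\le C\,\|Au\|_{L^2}\qquad\text{for all } u\in L^2(\mathbb T).$$ Let $m\in L^2(\mathbb T)$, and let $R(u)=\|Au-m\|_{L^2}^2$ if $Au\in L^2(\mathbb T)$ and $R(u)=\infty$ otherwise. Then the minimization problem $$\inf_{u\in L^1(\mathbb T)}\bigl(MS(u,\mathbf 1)+R(u)\bigr)$$ has a solution $u\in GSBV(\mathbb T)\cap L^1(\mathbb T)$. -/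

import Mathlib

open MeasureTheory Filter Topology
open scoped ENNReal NNReal ContDiff

noncomputable section

namespace MumfordShah

/-- The unit circle `𝕋 = ℝ / ℤ`; its Lebesgue measure `volume` has total mass one. -/
abbrev Circ : Type := UnitAddCircle

/-- `z ∈ ℝ ∪ {∞}` is the approximate limit of `u` at `t`: for every neighbourhood `V` of `z`,
`ρ⁻¹ |{s : |s - t| < ρ, u s ∉ V}| → 0` as `ρ → 0+`. -/
def IsApproxLimit (u : Circ → ℝ) (t : Circ) (z : OnePoint ℝ) : Prop :=
  ∀ V ∈ 𝓝 z, Tendsto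
    (fun ρ : ℝ => volume {s : Circ | dist s t < ρ ∧ (u s : OnePoint ℝ) ∉ V} / ENNReal.ofReal ρ)
    (𝓝[>] 0) (𝓝 0)

/-- `S_u`: the set of points at which `u` has no approximate limit in `ℝ ∪ {∞}`. -/
def jumpSet (u : Circ → ℝ) : Set Circ :=
  {t | ¬ ∃ z : OnePoint ℝ, IsApproxLimit u t z}

/-- Smooth functions on the circle. -/
def IsTestFunction (φ : Circ → ℝ) : Prop :=
  ContDiff ℝ ∞ (fun x : ℝ => φ (x : Circ))

/-- The derivative of a function on the circle. -/
def circleDeriv (φ : Circ → ℝ) (t : Circ) : ℝ :=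
  deriv (fun h : ℝ => φ (t + (h : Circ))) 0

/-- The finite signed measure `μ` is the distributional derivative of `u`:
`∫ u φ' dt = - ∫ φ dμ` for all smooth `φ`. -/
def IsDistribDeriv (u : Circ → ℝ) (μ : SignedMeasure Circ) : Prop :=
  ∀ φ : Circ → ℝ, IsTestFunction φ → ∫ t, u t * circleDeriv φ t = - ∫ᵛ t, φ t ∂•μ

/-- `BV(𝕋)`: integrable functions whose distributional derivative is a finite signed measure. -/
def IsBV (u : Circ → ℝ) : Prop :=
  Integrable u volume ∧ ∃ μ : SignedMeasure Circ, IsDistribDeriv u μ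

open Classical in
/-- The distributional derivative `Du` of `u ∈ BV(𝕋)` (zero if there is none). -/
def distribDeriv (u : Circ → ℝ) : SignedMeasure Circ :=
  if h : ∃ μ : SignedMeasure Circ, IsDistribDeriv u μ then h.choose else 0

/-- `SBV(𝕋)`: `u ∈ BV(𝕋)` and the Cantor part of `Du`, that is, the restriction to `𝕋 ∖ S_u` of
the singular part of `Du` with respect to Lebesgue measure, vanishes. -/
def IsSBV (u : Circ → ℝ) : Prop :=
  IsBV u ∧ ∀ E : Set Circ, MeasurableSet E → E ⊆ (jumpSet u)ᶜ →
    (distribDeriv u).singularPart volume E = 0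

/-- The truncation `min (k, max (u, -k))`. -/
def trunc (k : ℕ) (u : Circ → ℝ) (t : Circ) : ℝ :=
  min (k : ℝ) (max (u t) (-(k : ℝ)))

/-- `GSBV(𝕋)`: Borel functions all of whose truncations are in `SBV(𝕋)`. -/
def IsGSBV (u : Circ → ℝ) : Prop :=
  Measurable u ∧ ∀ k : ℕ, IsSBV (trunc k u)

/-- The approximate gradient `∇u` of `u ∈ GSBV(𝕋)`: almost everywhere on `{|u| < k}` it is
the Lebesgue density of the absolutely continuous part of `D(min (k, max (u, -k)))`. At the
point `t` the level `k = ⌊|u t|⌋ + 1` is used; up to null sets the choice of `k > |u t|` does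
not matter. -/
def approxGradient (u : Circ → ℝ) (t : Circ) : ℝ :=
  (distribDeriv (trunc (⌊|u t|⌋₊ + 1) u)).rnDeriv volume t

open Classical in
/-- `MS(u, v) = ∫ |∇u|² + #S_u` if `u ∈ GSBV(𝕋)` and `v = 1` a.e., and `∞` otherwise. -/
def MS (u v : Circ → ℝ) : ℝ≥0∞ :=
  if IsGSBV u ∧ v =ᵐ[volume] (fun _ => (1 : ℝ)) then
    (∫⁻ t, ‖approxGradient u t‖ₑ ^ 2) + ((jumpSet u).encard : ℝ≥0∞)
  else ∞

/-- `L^p(𝕋)`, real valued. -/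
abbrev LpCirc (p : ℝ≥0∞) : Type := Lp ℝ p (volume : Measure Circ)

open Classical in
/-- `R(u) = ‖Au - m‖²_{L²}` if `Au ∈ L²(𝕋)`, and `∞` otherwise. -/
def residual (A : LpCirc 1 → LpCirc 1) (m : LpCirc 2) (u : LpCirc 1) : ℝ≥0∞ :=
  if MemLp (A u) 2 volume then (eLpNorm (fun t => A u t - m t) 2 volume) ^ 2 else ∞

/-- The norm of `H^r(𝕋)`, `r ∈ ℝ`, as an extended number:
`‖u‖² = ‖(I - Δ)^{r/2} u‖²_{L²} = ∑_k (1 + (2πk)²)^r |û(k)|²`. -/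
def sobolevNorm (r : ℝ) (u : Circ → ℝ) : ℝ≥0∞ :=
  (∑' k : ℤ, ENNReal.ofReal ((1 + (2 * Real.pi * k) ^ 2) ^ r) *
    ‖fourierCoeff (T := 1) (fun t => (u t : ℂ)) k‖ₑ ^ 2) ^ (1 / 2 : ℝ)

end MumfordShah

end

/-!
The theorem is proved by the direct method. The compactness that it requires comes from the fact
that in one dimension functions of finite energy have a very explicit structure.

*Structure.* A function of bounded variation on the circle is, up to a constant, the distribution
function of its derivative (`IsDistribDeriv.exists_ae_eq`), so it has one-sided limits everywhere,
and its discontinuity set is the set of atoms of its derivative (`IsDistribDeriv.mem_jumpSet_iff`).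
Consequently a function `u` with `MS u 1 < ∞` is piecewise absolutely continuous: on each of
finitely many intervals it is a constant plus the primitive of its approximate gradient
(`exists_isPiecewise_of_MS_ne_top`). Two points need care. Approximate limits are taken in
`ℝ ∪ {∞}`, so a truncation of `u` can jump from `-k` to `k` at a point outside `S_u`; the set of
these points is finite and does not depend on `k` (`jumpSet_trunc_subset`,
`finite_jumpSet_trunc_one_diff`). And `u` is not assumed to be bounded, but as the gradients of its
truncations are bounded in `L¹` uniformly in the height, it turns out to be. Conversely, piecewise
absolutely continuous functions with `p` nodes have energy at most `∫ |g|² + p`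
(`IsPiecewise.MS_le`). The predicate `IsPiecewise` allows nodes to coincide, which makes it stable
under limits.

*Coercivity.* The energy alone does not control the constants on the pieces, and this is where the
hypothesis on `A` enters. Along a minimizing sequence `A u` is bounded in `L²`, so `u` is bounded in
`H^{-s}`. For `s < 1 / 2` the indicator function of an arc belongs to `H^s`, with a norm that tends
to zero with the length of the arc; by duality, so do the integrals of `u` over arcs, uniformly
along the sequence (`abs_integral_le_modulus`). This bounds the constants on pieces whose length is
bounded below, and shows that the mass on pieces that collapse tends to zero.

*Conclusion.* Pass to a subsequence along which the number of pieces is constant, the nodes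
converge, the gradients converge weakly in `L²`, and the constants on pieces that do not collapse
converge. Then the functions converge in `L¹` (`IsPiecewise.exists_of_tendsto`,
`IsPiecewise.exists_subseq_tendsto`) to a piecewise absolutely continuous function with the same
number of nodes. Both parts of the functional are lower semicontinuous along this sequence: the
first because the norm of `L²` is weakly lower semicontinuous, the second by Fatou's lemma
(`residual_le_of_tendsto`).
-/

noncomputable section

namespace MumfordShah

open Set

/-! ### The circle in the coordinate of the unit interval -/

/-- The representative in `(0, 1]` of a point of the circle. -/
def rep (t : Circ) : ℝ := (AddCircle.equivIoc (1 : ℝ) 0 t : ℝ)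

lemma rep_mem (t : Circ) : rep t ∈ Ioc (0 : ℝ) 1 := by
  have := (AddCircle.equivIoc (1 : ℝ) 0 t).2
  simpa [rep] using this

@[simp] lemma coe_rep (t : Circ) : ((rep t : ℝ) : Circ) = t :=
  (AddCircle.equivIoc (1 : ℝ) 0).symm_apply_apply t

lemma rep_coe {x : ℝ} (hx : x ∈ Ioc (0 : ℝ) 1) : rep (x : Circ) = x := by
  have h : x ∈ Ioc (0 : ℝ) (0 + 1) := by simpa using hx
  have := (AddCircle.equivIoc (1 : ℝ) 0).apply_symm_apply ⟨x, h⟩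
  exact congrArg Subtype.val this

lemma rep_injective : Function.Injective rep := fun a b h => by
  rw [← coe_rep a, h, coe_rep]

@[fun_prop] lemma measurable_rep : Measurable rep :=
  measurable_subtype_coe.comp (AddCircle.measurableEquivIoc (1 : ℝ) 0).measurable

@[fun_prop] lemma measurable_coe_circ : Measurable (fun x : ℝ => (x : Circ)) :=
  AddCircle.measurable_mk'

lemma measurePreserving_coe :
    MeasurePreserving (fun x : ℝ => (x : Circ)) (volume.restrict (Ioc (0 : ℝ) 1)) volume := by
  simpa using UnitAddCircle.measurePreserving_mk 0

lemma measurePreserving_rep :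
    MeasurePreserving rep volume (volume.restrict (Ioc (0 : ℝ) 1)) := by
  refine ⟨measurable_rep, ?_⟩
  rw [← measurePreserving_coe.map_eq, Measure.map_map measurable_rep measurable_coe_circ]
  conv_rhs => rw [← Measure.map_id (μ := volume.restrict (Ioc (0 : ℝ) 1))]
  refine Measure.map_congr ?_
  filter_upwards [ae_restrict_mem measurableSet_Ioc] with x hx using rep_coe hx

lemma ae_circ_iff {p : Circ → Prop} :
    (∀ᵐ t : Circ, p t) ↔ ∀ᵐ x : ℝ ∂(volume.restrict (Ioc (0 : ℝ) 1)), p (x : Circ) := by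
  constructor
  · exact fun h => measurePreserving_coe.quasiMeasurePreserving.ae h
  · intro h
    filter_upwards [measurePreserving_rep.quasiMeasurePreserving.ae h] with t ht
    simpa using ht

lemma integral_circ (f : Circ → ℝ) : ∫ t, f t = ∫ x in (0 : ℝ)..1, f (x : Circ) := by
  have := UnitAddCircle.intervalIntegral_preimage 0 f
  simpa using this.symm

lemma integrable_circ_iff {f : Circ → ℝ} :
    Integrable f ↔ IntegrableOn (fun x : ℝ => f (x : Circ)) (Ioc (0 : ℝ) 1) := by
  constructor
  · exact fun h => measurePreserving_coe.integrable_comp_of_integrable h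
  · intro h
    have := measurePreserving_rep.integrable_comp_of_integrable h
    simpa [Function.comp_def] using this

lemma integral_comp_rep (g : ℝ → ℝ) : ∫ t : Circ, g (rep t) = ∫ x in (0 : ℝ)..1, g x := by
  rw [integral_circ, intervalIntegral.integral_of_le zero_le_one,
    intervalIntegral.integral_of_le zero_le_one]
  refine integral_congr_ae ?_
  filter_upwards [ae_restrict_mem measurableSet_Ioc] with x hx
  rw [rep_coe hx]

lemma setIntegral_rep_le {g : Circ → ℝ} {x : ℝ} (hx : x ∈ Icc (0 : ℝ) 1) :
    ∫ t in {t : Circ | rep t ≤ x}, g t = ∫ y in (0 : ℝ)..x, g (y : Circ) := by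
  have hm : MeasurableSet {t : Circ | rep t ≤ x} := measurable_rep measurableSet_Iic
  rw [← integral_indicator hm, integral_circ, intervalIntegral.integral_of_le zero_le_one,
    intervalIntegral.integral_of_le hx.1]
  have h2 : Ioc (0 : ℝ) x = Iic x ∩ Ioc (0 : ℝ) 1 := by
    ext y; simp only [mem_Ioc, mem_inter_iff, mem_Iic]
    exact ⟨fun h => ⟨h.2, h.1, h.2.trans hx.2⟩, fun h => ⟨h.2.1, h.1⟩⟩
  rw [h2, ← Measure.restrict_restrict measurableSet_Iic, ← integral_indicator measurableSet_Iic]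
  refine integral_congr_ae ?_
  filter_upwards [ae_restrict_mem measurableSet_Ioc] with y hy
  simp only [indicator, mem_ofPred_eq, rep_coe hy, mem_Iic]

/-! ### Integrals against signed measures -/

lemma signedMeasure_apply (μ : SignedMeasure Circ) {E : Set Circ} (hE : MeasurableSet E) :
    μ E = μ.toJordanDecomposition.posPart.real E - μ.toJordanDecomposition.negPart.real E := by
  conv_lhs => rw [← SignedMeasure.toSignedMeasure_toJordanDecomposition μ,
    JordanDecomposition.toSignedMeasure]
  simp [hE, Measure.toSignedMeasure_apply]

instance (μ : SignedMeasure Circ) : IsFiniteMeasure μ.variation := by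
  rw [← SignedMeasure.totalVariation_eq_variation, SignedMeasure.totalVariation]
  infer_instance

lemma integrable_of_continuous {φ : Circ → ℝ} (hφ : Continuous φ) (P : Measure Circ)
    [IsFiniteMeasure P] : Integrable φ P :=
  hφ.integrable_of_hasCompactSupport (HasCompactSupport.of_compactSpace φ)

lemma vintegral_toSignedMeasure (P : Measure Circ) [IsFiniteMeasure P] (φ : Circ → ℝ) :
    ∫ᵛ t, φ t ∂•P.toSignedMeasure = ∫ t, φ t ∂P := by
  rw [← VectorMeasure.integral_toSignedMeasure]
  congr 1
  ext
  simp

lemma vintegral_eq (μ : SignedMeasure Circ) {φ : Circ → ℝ} (hφ : Continuous φ) :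
    ∫ᵛ t, φ t ∂•μ = ∫ t, φ t ∂μ.toJordanDecomposition.posPart -
      ∫ t, φ t ∂μ.toJordanDecomposition.negPart := by
  conv_lhs => rw [← SignedMeasure.toSignedMeasure_toJordanDecomposition μ,
    JordanDecomposition.toSignedMeasure]
  rw [VectorMeasure.integral_sub_vectorMeasure (integrable_of_continuous hφ _)
    (integrable_of_continuous hφ _), vintegral_toSignedMeasure, vintegral_toSignedMeasure]

lemma vintegral_withDensity {g φ : Circ → ℝ} (hg : Integrable g) (hφ : Continuous φ) :
    ∫ᵛ t, φ t ∂•(volume.withDensityᵥ g) = ∫ t, φ t * g t := by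
  have h1 := withDensityᵥ_eq_withDensity_pos_part_sub_withDensity_neg_part hg
  have : IsFiniteMeasure (volume.withDensity fun x => ENNReal.ofReal (g x)) :=
    isFiniteMeasure_withDensity_ofReal hg.2
  have : IsFiniteMeasure (volume.withDensity fun x => ENNReal.ofReal (-g x)) :=
    isFiniteMeasure_withDensity_ofReal hg.neg.2
  rw [h1, VectorMeasure.integral_sub_vectorMeasure (integrable_of_continuous hφ _)
    (integrable_of_continuous hφ _), vintegral_toSignedMeasure, vintegral_toSignedMeasure,
    integral_withDensity_eq_integral_toReal_smul₀ hg.1.aemeasurable.ennreal_ofReal (by simp),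
    integral_withDensity_eq_integral_toReal_smul₀ (f := fun x => ENNReal.ofReal (-g x))
      hg.1.aemeasurable.neg.ennreal_ofReal (by simp)]
  obtain ⟨C, hC⟩ : ∃ C, ∀ t, ‖φ t‖ ≤ C := by
    obtain ⟨C, hC⟩ := isCompact_univ.exists_bound_of_continuousOn hφ.continuousOn
    exact ⟨C, fun t => hC t (mem_univ t)⟩
  rw [← integral_sub]
  · refine integral_congr_ae (Eventually.of_forall fun t => ?_)
    simp only [smul_eq_mul, ENNReal.toReal_ofReal']
    rcases le_total 0 (g t) with h | h
    · rw [max_eq_left h, max_eq_right (by linarith)]; ring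
    · rw [max_eq_right h, max_eq_left (by linarith)]; ring
  · simp only [smul_eq_mul, ENNReal.toReal_ofReal']
    exact hg.pos_part.mul_bdd hφ.aestronglyMeasurable (Eventually.of_forall hC)
  · simp only [smul_eq_mul, ENNReal.toReal_ofReal']
    exact hg.neg_part.mul_bdd hφ.aestronglyMeasurable (Eventually.of_forall hC)

/-! ### Test functions and uniqueness of the distributional derivative -/

lemma continuous_of_comp_coe {φ : Circ → ℝ} (h : Continuous fun x : ℝ => φ (x : Circ)) :
    Continuous φ :=
  isQuotientMap_quotient_mk'.continuous_iff.2 h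

lemma IsTestFunction.continuous {φ : Circ → ℝ} (h : IsTestFunction φ) : Continuous φ :=
  continuous_of_comp_coe (ContDiff.continuous h)

lemma circleDeriv_coe (φ : Circ → ℝ) (x : ℝ) :
    circleDeriv φ (x : Circ) = deriv (fun y : ℝ => φ (y : Circ)) x := by
  have := deriv_comp_const_add (f := fun y : ℝ => φ (y : Circ)) x 0
  simpa [circleDeriv] using this

/-- The real part of the character `e^{2πikt}`. -/
def cosine (k : ℤ) (t : Circ) : ℝ := (fourier (T := (1 : ℝ)) k t).re

/-- The imaginary part of the character `e^{2πikt}`. -/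
def sine (k : ℤ) (t : Circ) : ℝ := (fourier (T := (1 : ℝ)) k t).im

lemma cosine_coe (k : ℤ) (x : ℝ) : cosine k (x : Circ) = Real.cos (2 * Real.pi * k * x) := by
  rw [cosine, fourier_coe_apply, ← Complex.exp_ofReal_mul_I_re]
  congr 2; push_cast; ring

lemma sine_coe (k : ℤ) (x : ℝ) : sine k (x : Circ) = Real.sin (2 * Real.pi * k * x) := by
  rw [sine, fourier_coe_apply, ← Complex.exp_ofReal_mul_I_im]
  congr 2; push_cast; ring

lemma isTestFunction_cosine (k : ℤ) : IsTestFunction (cosine k) := by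
  simp only [IsTestFunction, cosine_coe]; fun_prop

lemma isTestFunction_sine (k : ℤ) : IsTestFunction (sine k) := by
  simp only [IsTestFunction, sine_coe]; fun_prop

lemma circleDeriv_cosine (k : ℤ) (t : Circ) :
    circleDeriv (cosine k) t = -(2 * Real.pi * k) * sine k t := by
  rw [← coe_rep t, circleDeriv_coe, sine_coe]
  simp only [cosine_coe]
  have := ((hasDerivAt_id (rep t)).const_mul (2 * Real.pi * k)).cos
  simp only [id] at this
  rw [this.deriv]; ring

lemma circleDeriv_sine (k : ℤ) (t : Circ) :
    circleDeriv (sine k) t = (2 * Real.pi * k) * cosine k t := by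
  rw [← coe_rep t, circleDeriv_coe, cosine_coe]
  simp only [sine_coe]
  have := ((hasDerivAt_id (rep t)).const_mul (2 * Real.pi * k)).sin
  simp only [id] at this
  rw [this.deriv]; ring

/-- A finite measure on the circle is determined by its Fourier coefficients, since trigonometric
polynomials separate points. -/
lemma measure_eq_of_fourier {P Q : Measure Circ} [IsFiniteMeasure P] [IsFiniteMeasure Q]
    (h : ∀ k : ℤ, ∫ t, fourier (T := (1 : ℝ)) k t ∂P = ∫ t, fourier (T := (1 : ℝ)) k t ∂Q) :
    P = Q := by
  let A : StarSubalgebra ℂ (BoundedContinuousFunction Circ ℂ) :=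
    (fourierSubalgebra (T := (1 : ℝ))).comap (BoundedContinuousFunction.toContinuousMapStarₐ ℂ)
  have key : ∀ f ∈ Submodule.span ℂ (range (fourier (T := (1 : ℝ)))),
      ∫ t, f t ∂P = ∫ t, f t ∂Q := by
    have int : ∀ (f : C(Circ, ℂ)) (S : Measure Circ) [IsFiniteMeasure S], Integrable f S :=
      fun f S _ => f.continuous.integrable_of_hasCompactSupport
        (HasCompactSupport.of_compactSpace f)
    intro f hf
    induction hf using Submodule.span_induction with
    | mem f hf => obtain ⟨k, rfl⟩ := hf; exact h k
    | zero => simp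
    | add f g _ _ hf hg =>
      simp only [ContinuousMap.add_apply]
      rw [integral_add (int f P) (int g P), integral_add (int f Q) (int g Q), hf, hg]
    | smul c f _ hf =>
      simp only [ContinuousMap.smul_apply]
      rw [integral_smul, integral_smul, hf]
  refine ext_of_forall_mem_subalgebra_integral_eq_of_polish (A := A) (𝕜 := ℂ) ?_ ?_
  · intro x y hxy
    obtain ⟨-, ⟨f, hf, rfl⟩, hne⟩ := fourierSubalgebra_separatesPoints (T := (1 : ℝ)) hxy
    refine ⟨f, ⟨f, ⟨BoundedContinuousFunction.mkOfCompact f, ?_, ?_⟩, rfl⟩, hne⟩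
    · exact hf
    · rfl
  · intro g hg
    refine key (BoundedContinuousFunction.toContinuousMapStarₐ ℂ g) ?_
    rw [← fourierSubalgebra_coe]
    exact hg

/-- A signed measure that annihilates all trigonometric polynomials vanishes. -/
lemma signedMeasure_eq_zero {σ : SignedMeasure Circ}
    (hc : ∀ k : ℤ, ∫ᵛ t, cosine k t ∂•σ = 0) (hs : ∀ k : ℤ, ∫ᵛ t, sine k t ∂•σ = 0) : σ = 0 := by
  rw [← SignedMeasure.toSignedMeasure_toJordanDecomposition σ,
    JordanDecomposition.toSignedMeasure, sub_eq_zero]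
  congr 1
  refine measure_eq_of_fourier fun k => ?_
  have int : ∀ (R : Measure Circ) [IsFiniteMeasure R],
      Integrable (fun t => fourier (T := (1 : ℝ)) k t) R :=
    fun R _ => (fourier k).continuous.integrable_of_hasCompactSupport
      (HasCompactSupport.of_compactSpace _)
  have h1 := hc k
  have h2 := hs k
  rw [vintegral_eq _ (isTestFunction_cosine k).continuous, sub_eq_zero] at h1
  rw [vintegral_eq _ (isTestFunction_sine k).continuous, sub_eq_zero] at h2
  apply Complex.ext
  · have a := integral_re (int σ.toJordanDecomposition.posPart)
    have b := integral_re (int σ.toJordanDecomposition.negPart)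
    simp only [RCLike.re_to_complex] at a b
    rw [← a, ← b]; exact h1
  · have a := integral_im (int σ.toJordanDecomposition.posPart)
    have b := integral_im (int σ.toJordanDecomposition.negPart)
    simp only [RCLike.im_to_complex] at a b
    rw [← a, ← b]; exact h2

lemma IsDistribDeriv.unique {u : Circ → ℝ} {μ ν : SignedMeasure Circ} (hμ : IsDistribDeriv u μ)
    (hν : IsDistribDeriv u ν) : μ = ν := by
  rw [← sub_eq_zero]
  have key : ∀ φ, IsTestFunction φ → ∫ᵛ t, φ t ∂•(μ - ν) = 0 := by
    intro φ hφ
    rw [VectorMeasure.integral_sub_vectorMeasure (integrable_of_continuous hφ.continuous _)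
      (integrable_of_continuous hφ.continuous _)]
    have a := hμ φ hφ
    have b := hν φ hφ
    linarith
  exact signedMeasure_eq_zero (fun k => key _ (isTestFunction_cosine k))
    (fun k => key _ (isTestFunction_sine k))

lemma IsDistribDeriv.distribDeriv_eq {u : Circ → ℝ} {μ : SignedMeasure Circ}
    (hμ : IsDistribDeriv u μ) : distribDeriv u = μ := by
  have h : ∃ μ : SignedMeasure Circ, IsDistribDeriv u μ := ⟨μ, hμ⟩
  rw [distribDeriv, dif_pos h]
  exact h.choose_spec.unique hμ

lemma IsBV.isDistribDeriv {u : Circ → ℝ} (h : IsBV u) : IsDistribDeriv u (distribDeriv u) := by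
  rw [distribDeriv, dif_pos h.2]
  exact h.2.choose_spec

/-- A function that is orthogonal to the derivatives of all test functions is constant. With its
mean value subtracted it is orthogonal to all trigonometric polynomials, because those without
constant term are derivatives. -/
lemma ae_eq_const_of_integral_circleDeriv_eq_zero {f : Circ → ℝ} (hf : Integrable f)
    (h : ∀ φ, IsTestFunction φ → ∫ t, f t * circleDeriv φ t = 0) :
    ∃ c : ℝ, ∀ᵐ t, f t = c := by
  set c := ∫ t, f t with hc
  have hfc : Integrable (fun t => f t - c) := hf.sub (integrable_const c)
  have bdd : ∀ {φ : Circ → ℝ}, Continuous φ → Integrable (fun t => f t * φ t) := by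
    intro φ hφ
    obtain ⟨C, hC⟩ := isCompact_univ.exists_bound_of_continuousOn hφ.continuousOn
    exact hf.mul_bdd hφ.aestronglyMeasurable (Eventually.of_forall fun t => hC t (mem_univ t))
  have red : ∀ {φ : Circ → ℝ}, Continuous φ → ∫ᵛ t, φ t ∂•(volume.withDensityᵥ fun t => f t - c) =
      (∫ t, f t * φ t) - c * ∫ t, φ t := by
    intro φ hφ
    rw [vintegral_withDensity hfc hφ, ← integral_const_mul, ← integral_sub (bdd hφ)
      ((integrable_of_continuous hφ volume).const_mul c)]
    congr 1; ext t; ring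
  have mean : ∀ φ, IsTestFunction φ → ∫ t, circleDeriv φ t = 0 := by
    intro φ hφ
    have hd : ∀ x : ℝ, DifferentiableAt ℝ (fun y : ℝ => φ (y : Circ)) x := fun x =>
      (ContDiff.differentiable hφ (by simp)) x
    rw [integral_circ]
    simp only [circleDeriv_coe]
    rw [intervalIntegral.integral_deriv_eq_sub (fun x _ => hd x)]
    · have h01 : ((1 : ℝ) : Circ) = ((0 : ℝ) : Circ) := by
        simp
      rw [h01, sub_self]
    · exact (ContDiff.continuous_deriv hφ (by simp)).intervalIntegrable _ _
  have zero : volume.withDensityᵥ (fun t => f t - c) = 0 := by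
    refine signedMeasure_eq_zero (fun k => ?_) (fun k => ?_)
    · rw [red (isTestFunction_cosine k).continuous]
      rcases eq_or_ne k 0 with rfl | hk
      · simp [cosine, hc, measureReal_def]
      · have a := h _ (isTestFunction_sine k)
        have b := mean _ (isTestFunction_sine k)
        simp only [circleDeriv_sine] at a b
        have hk' : (2 * Real.pi * k : ℝ) ≠ 0 := by simp [hk, Real.pi_ne_zero]
        simp only [mul_left_comm (f _) (2 * Real.pi * (k : ℝ))] at a
        rw [integral_const_mul] at a b
        rw [(mul_eq_zero.1 a).resolve_left hk', (mul_eq_zero.1 b).resolve_left hk']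
        simp
    · rw [red (isTestFunction_sine k).continuous]
      rcases eq_or_ne k 0 with rfl | hk
      · simp [sine]
      · have a := h _ (isTestFunction_cosine k)
        have b := mean _ (isTestFunction_cosine k)
        simp only [circleDeriv_cosine] at a b
        have hk' : (-(2 * Real.pi * k) : ℝ) ≠ 0 := by simp [hk, Real.pi_ne_zero]
        simp only [mul_left_comm (f _) (-(2 * Real.pi * (k : ℝ)))] at a
        rw [integral_const_mul] at a b
        rw [(mul_eq_zero.1 a).resolve_left hk', (mul_eq_zero.1 b).resolve_left hk']
        simp
  refine ⟨c, ?_⟩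
  have := hfc.ae_eq_of_withDensityᵥ_eq (integrable_zero _ _ _) (g := 0)
    (by rw [zero, withDensityᵥ_zero])
  filter_upwards [this] with t ht
  simpa [sub_eq_zero] using ht

lemma measurableSet_rep_le (x : ℝ) : MeasurableSet {t : Circ | rep t ≤ x} :=
  measurable_rep measurableSet_Iic

/-- Integration by parts for distribution functions, by Fubini's theorem. -/
lemma integral_cdf_mul_deriv (P : Measure Circ) [IsFiniteMeasure P] {f : ℝ → ℝ}
    (hf : ContDiff ℝ 1 f) :
    ∫ x in (0 : ℝ)..1, P.real {t | rep t ≤ x} * deriv f x =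
      f 1 * P.real univ - ∫ t, f (rep t) ∂P := by
  have hf' : Continuous (deriv f) := hf.continuous_deriv le_rfl
  have hint : ∀ a b : ℝ, IntervalIntegrable (deriv f) volume a b :=
    fun a b => hf'.intervalIntegrable a b
  have h1 : ∀ x, P.real {t | rep t ≤ x} * deriv f x =
      ∫ t, (if rep t ≤ x then deriv f x else 0) ∂P := by
    intro x
    rw [show (fun t => if rep t ≤ x then deriv f x else 0) =
      {t : Circ | rep t ≤ x}.indicator (fun _ => deriv f x) by ext t; simp [indicator],
      integral_indicator_const _ (measurableSet_rep_le x), smul_eq_mul]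
  simp only [h1]
  rw [intervalIntegral.integral_of_le zero_le_one, integral_integral_swap]
  · have h2 : ∀ t : Circ, ∫ x in Ioc (0 : ℝ) 1, (if rep t ≤ x then deriv f x else 0) =
        f 1 - f (rep t) := by
      intro t
      have ht := rep_mem t
      rw [show (fun x => if rep t ≤ x then deriv f x else 0) =
        (Ici (rep t)).indicator (deriv f) by ext x; simp [indicator],
        setIntegral_indicator measurableSet_Ici]
      have : Ioc (0 : ℝ) 1 ∩ Ici (rep t) = Icc (rep t) 1 := by
        ext x; simp only [mem_inter_iff, mem_Ioc, mem_Ici, mem_Icc]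
        exact ⟨fun h => ⟨h.2, h.1.2⟩, fun h => ⟨⟨ht.1.trans_le h.1, h.2⟩, h.1⟩⟩
      rw [this, integral_Icc_eq_integral_Ioc, ← intervalIntegral.integral_of_le ht.2,
        intervalIntegral.integral_deriv_eq_sub
          (fun x _ => (hf.differentiable (by simp)).differentiableAt) (hint _ _)]
    simp only [h2]
    have hb : Integrable (fun t => f (rep t)) P := by
      obtain ⟨C, hC⟩ := isCompact_Icc.exists_bound_of_continuousOn
        (s := Icc (0 : ℝ) 1) hf.continuous.continuousOn
      exact Integrable.of_bound
        (hf.continuous.measurable.comp measurable_rep).aestronglyMeasurable C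
        (Eventually.of_forall fun t => hC _ (Ioc_subset_Icc_self (rep_mem t)))
    rw [integral_sub (integrable_const _) hb]
    simp [mul_comm]
  · have hb : Integrable (fun z : ℝ × Circ => deriv f z.1)
        ((volume.restrict (Ioc (0 : ℝ) 1)).prod P) :=
      Integrable.comp_fst
        ((intervalIntegrable_iff_integrableOn_Ioc_of_le zero_le_one).1 (hint 0 1)) P
    have hm : MeasurableSet {z : ℝ × Circ | rep z.2 ≤ z.1} :=
      measurableSet_le (measurable_rep.comp measurable_snd) measurable_fst
    refine (hb.indicator hm).congr (Eventually.of_forall fun z => ?_)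
    simp [indicator, Function.uncurry]

/-- A function of bounded variation is, up to a constant, the distribution function of its
derivative, and the derivative has total mass zero. -/
lemma IsDistribDeriv.exists_ae_eq {u : Circ → ℝ} {μ : SignedMeasure Circ} (hu : Integrable u)
    (h : IsDistribDeriv u μ) :
    μ univ = 0 ∧ ∃ c : ℝ, ∀ᵐ t, u t = c + μ {s | rep s ≤ rep t} := by
  -- the constant test function
  have huniv : μ univ = 0 := by
    have := h (fun _ => 1) (by simpa [IsTestFunction] using contDiff_const)
    simp [circleDeriv] at this
    exact this
  refine ⟨huniv, ?_⟩
  set P := μ.toJordanDecomposition.posPart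
  set N := μ.toJordanDecomposition.negPart
  have hcdf : ∀ R : Measure Circ, IsFiniteMeasure R →
      Integrable (fun t => R.real {s | rep s ≤ rep t}) := by
    intro R _
    have hmono : Monotone fun x : ℝ => R.real {s : Circ | rep s ≤ x} := fun x y hxy =>
      measureReal_mono (fun s hs => le_trans hs hxy)
    exact Integrable.of_bound (hmono.measurable.comp measurable_rep).aestronglyMeasurable
      (R.real univ) (Eventually.of_forall fun t => by
        rw [Real.norm_of_nonneg measureReal_nonneg]
        exact measureReal_mono (subset_univ _))
  have hμ : ∀ t, μ {s | rep s ≤ rep t} = P.real {s | rep s ≤ rep t} - N.real {s | rep s ≤ rep t} :=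
    fun t => signedMeasure_apply μ (measurableSet_rep_le _)
  have hI : Integrable (fun t => μ {s | rep s ≤ rep t}) := by
    simp only [hμ]
    exact (hcdf P inferInstance).sub (hcdf N inferInstance)
  obtain ⟨c, hc⟩ := ae_eq_const_of_integral_circleDeriv_eq_zero (hu.sub hI) (by
    intro φ hφ
    have hcd : Continuous (circleDeriv φ) := by
      refine continuous_of_comp_coe ?_
      simp only [circleDeriv_coe]
      exact ContDiff.continuous_deriv hφ (by simp)
    obtain ⟨C, hC⟩ := isCompact_univ.exists_bound_of_continuousOn hcd.continuousOn
    have bdd : ∀ {f : Circ → ℝ}, Integrable f → Integrable (fun t => f t * circleDeriv φ t) :=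
      fun hf => hf.mul_bdd hcd.aestronglyMeasurable
        (Eventually.of_forall fun t => hC t (mem_univ t))
    have fub : ∀ Q : Measure Circ, IsFiniteMeasure Q →
        ∫ t, Q.real {s | rep s ≤ rep t} * circleDeriv φ t = φ 0 * Q.real univ - ∫ t, φ t ∂Q := by
      intro Q _
      have := integral_cdf_mul_deriv Q (f := fun x : ℝ => φ (x : Circ)) (hφ.of_le (by simp))
      simp only [coe_rep] at this
      have h01 : ((1 : ℝ) : Circ) = 0 := by
        simp
      rw [h01] at this
      rw [← this, ← integral_comp_rep]
      refine integral_congr_ae (Eventually.of_forall fun t => ?_)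
      change _ = _ * deriv (fun x : ℝ => φ (x : Circ)) (rep t)
      rw [← circleDeriv_coe, coe_rep]
    simp only [Pi.sub_apply, sub_mul]
    rw [integral_sub (bdd hu) (bdd hI), h φ hφ, vintegral_eq _ hφ.continuous]
    simp only [hμ, sub_mul]
    rw [integral_sub (bdd (hcdf P inferInstance)) (bdd (hcdf N inferInstance)),
      fub P inferInstance, fub N inferInstance]
    have := signedMeasure_apply μ MeasurableSet.univ
    rw [huniv] at this
    have h3 : P.real univ = N.real univ := by linarith
    rw [h3]; change -((∫ t, φ t ∂P) - ∫ t, φ t ∂N) - _ = 0; ring)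
  refine ⟨c, ?_⟩
  filter_upwards [hc] with t ht
  simp only [Pi.sub_apply] at ht
  linarith

/-! ### Approximate limits and one-sided limits -/

/-- The filter of sets whose complement has density zero at `t`; an approximate limit at `t` is a
limit along this filter. -/
def densityFilter (t : Circ) : Filter Circ where
  sets := {A | Tendsto (fun ρ : ℝ => volume {s : Circ | dist s t < ρ ∧ s ∉ A} / ENNReal.ofReal ρ)
    (𝓝[>] 0) (𝓝 0)}
  univ_sets := by simp
  sets_of_superset := by
    intro A B hA hAB
    refine tendsto_of_tendsto_of_tendsto_of_le_of_le tendsto_const_nhds hA (fun _ => zero_le)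
      (fun ρ => ?_)
    dsimp only
    gcongr
  inter_sets := by
    intro A B hA hB
    have := Tendsto.add hA hB
    rw [add_zero] at this
    refine tendsto_of_tendsto_of_tendsto_of_le_of_le tendsto_const_nhds this (fun _ => zero_le)
      (fun ρ => ?_)
    dsimp only
    rw [← ENNReal.add_div]
    gcongr
    refine (measure_mono ?_).trans (measure_union_le _ _)
    rintro s ⟨h1, h2⟩
    by_cases hs : s ∈ A
    · exact Or.inr ⟨h1, fun hb => h2 ⟨hs, hb⟩⟩
    · exact Or.inl ⟨h1, hs⟩

/-- Holds by definition, as filters are defined by their sets. -/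
lemma isApproxLimit_iff {u : Circ → ℝ} {t : Circ} {z : OnePoint ℝ} :
    IsApproxLimit u t z ↔ Tendsto (fun s => (u s : OnePoint ℝ)) (densityFilter t) (𝓝 z) :=
  Iff.rfl

/-- Points of the circle immediately to the right of `x`, up to null sets. -/
def rightFilter (x : ℝ) : Filter Circ := (𝓝[>] x ⊓ ae volume).map (fun y : ℝ => (y : Circ))

/-- Points of the circle immediately to the left of `x`, up to null sets. -/
def leftFilter (x : ℝ) : Filter Circ := (𝓝[<] x ⊓ ae volume).map (fun y : ℝ => (y : Circ))

/-- Any interval of length one may serve as a fundamental domain; points of the circle are studied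
in an interval around them. -/
lemma ae_circ_of_ae_Ioc (a : ℝ) {p : Circ → Prop}
    (h : ∀ᵐ x : ℝ ∂(volume.restrict (Ioc a (a + 1))), p (x : Circ)) : ∀ᵐ t, p t := by
  have hmp : MeasurePreserving (Subtype.val : Ioc a (a + 1) → ℝ)
      (Measure.comap Subtype.val volume) (volume.restrict (Ioc a (a + 1))) :=
    ⟨measurable_subtype_coe, map_comap_subtype_coe measurableSet_Ioc volume⟩
  filter_upwards [(hmp.comp (AddCircle.measurePreserving_equivIoc (T := 1)
    (a := a))).quasiMeasurePreserving.ae h] with t ht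
  have : (((AddCircle.equivIoc (1 : ℝ) a t : ℝ)) : Circ) = t :=
    (AddCircle.equivIoc (1 : ℝ) a).symm_apply_apply t
  rwa [Function.comp_apply, this] at ht

lemma dist_coe_coe {x y : ℝ} (h : |x - y| ≤ 1 / 2) : dist (x : Circ) (y : Circ) = |x - y| := by
  rw [dist_eq_norm, ← AddCircle.coe_sub, AddCircle.norm_coe_eq_abs_iff 1 one_ne_zero]
  simpa using h

/-- A limit from both sides is an approximate limit. -/
lemma densityFilter_le (x : ℝ) : densityFilter (x : Circ) ≤ leftFilter x ⊔ rightFilter x := by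
  rintro A ⟨hl, hr⟩
  rw [leftFilter, mem_map] at hl
  rw [rightFilter, mem_map] at hr
  have h : ∀ᶠ y : ℝ in 𝓝[≠] x ⊓ ae volume, (y : Circ) ∈ A := by
    rw [← Iio_union_Ioi, nhdsWithin_union, inf_sup_right]
    exact ⟨hl, hr⟩
  rw [eventually_inf] at h
  obtain ⟨U, hU, V, hV, hUV⟩ := h
  obtain ⟨δ, hδ, hδU⟩ := Metric.mem_nhdsWithin_iff.1 hU
  change Tendsto _ _ _
  refine tendsto_const_nhds.congr' ?_
  have hpos : 0 < min δ (1 / 2) := by positivity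
  filter_upwards [Ioo_mem_nhdsGT hpos] with ρ hρ
  have : volume {s : Circ | dist s x < ρ ∧ s ∉ A} = 0 := by
    rw [← compl_compl {s : Circ | dist s x < ρ ∧ s ∉ A}]
    refine ae_circ_of_ae_Ioc (x - 1 / 2) ?_
    rw [ae_restrict_iff' measurableSet_Ioc]
    filter_upwards [hV, compl_mem_ae_iff.2 (measure_singleton x)] with y hy hyx hyI
    rintro ⟨h1, h2⟩
    have habs : |y - x| ≤ 1 / 2 := by
      rw [abs_le]; constructor <;> linarith [hyI.1, hyI.2]
    rw [dist_coe_coe habs] at h1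
    refine h2 (hUV y ⟨hδU ⟨?_, hyx⟩, hy⟩)
    rw [Metric.mem_ball, Real.dist_eq]
    exact h1.trans (hρ.2.trans_le (min_le_left _ _))
  simp [this]

lemma ae_line_of_ae_circ {p : Circ → Prop} (h : ∀ᵐ t, p t) (x : ℝ) :
    ∀ᶠ y : ℝ in 𝓝 x ⊓ ae volume, p (y : Circ) := by
  have := (UnitAddCircle.measurePreserving_mk (x - 1 / 2)).quasiMeasurePreserving.ae h
  rw [ae_restrict_iff' measurableSet_Ioc] at this
  rw [eventually_inf]
  refine ⟨_, Ioo_mem_nhds (a := x - 1 / 2) (b := x + 1 / 2) (by linarith) (by linarith), _, this,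
    fun y hy => hy.2 ⟨hy.1.1, by linarith [hy.1.2]⟩⟩

/-- A set that contains a punctured one-sided neighbourhood of a point up to a null set has
positive density there. -/
lemma not_mem_densityFilter {x : ℝ} {A : Set Circ} {δ : ℝ} (hδ : 0 < δ)
    (h : (∀ᵐ y : ℝ, y ∈ Ioo x (x + δ) → (y : Circ) ∉ A) ∨
      (∀ᵐ y : ℝ, y ∈ Ioo (x - δ) x → (y : Circ) ∉ A)) : A ∉ densityFilter (x : Circ) := by
  intro hA
  change Tendsto _ _ _ at hA
  have h1 : ∀ᶠ ρ in 𝓝[>] (0 : ℝ), volume {s : Circ | dist s x < ρ ∧ s ∉ A} / ENNReal.ofReal ρ < 1 :=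
    hA.eventually_lt_const one_pos
  have hpos : 0 < min δ (1 / 2) := by positivity
  obtain ⟨ρ, hρ1, hρ⟩ := (h1.and (Ioo_mem_nhdsGT hpos)).exists
  have hρδ : ρ < δ := hρ.2.trans_le (min_le_left _ _)
  have hρ2 : ρ < 1 / 2 := hρ.2.trans_le (min_le_right _ _)
  refine absurd hρ1 (not_lt.2 ?_)
  rw [ENNReal.le_div_iff_mul_le (Or.inl (by simpa using hρ.1)) (Or.inl ENNReal.ofReal_ne_top),
    one_mul]
  set S := {s : Circ | dist s x < ρ ∧ s ∉ A}
  rw [← measure_toMeasurable S,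
    ← (UnitAddCircle.measurePreserving_mk (x - 1 / 2)).measure_preimage
      (measurableSet_toMeasurable volume S).nullMeasurableSet,
    Measure.restrict_apply (measurable_coe_circ (measurableSet_toMeasurable _ _))]
  rcases h with h | h
  · calc ENNReal.ofReal ρ = volume (Ioo x (x + ρ)) := by rw [Real.volume_Ioo]; congr 1; ring
      _ ≤ _ := by
        refine measure_mono_ae ?_
        filter_upwards [h] with y hy hyI
        have habs : |y - x| = y - x := abs_of_pos (by linarith [hyI.1])
        refine ⟨subset_toMeasurable _ _ ⟨?_, hy ⟨hyI.1, by linarith [hyI.2]⟩⟩, ?_, ?_⟩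
        · rw [dist_coe_coe (by rw [habs]; linarith [hyI.2]), habs]; linarith [hyI.2]
        · linarith [hyI.1]
        · linarith [hyI.2]
  · calc ENNReal.ofReal ρ = volume (Ioo (x - ρ) x) := by rw [Real.volume_Ioo]; congr 1; ring
      _ ≤ _ := by
        refine measure_mono_ae ?_
        filter_upwards [h] with y hy hyI
        have habs : |y - x| = x - y := by rw [abs_sub_comm, abs_of_pos (by linarith [hyI.2])]
        refine ⟨subset_toMeasurable _ _ ⟨?_, hy ⟨by linarith [hyI.1], hyI.2⟩⟩, ?_, ?_⟩
        · rw [dist_coe_coe (by rw [habs]; linarith [hyI.1]), habs]; linarith [hyI.1]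
        · linarith [hyI.1]
        · linarith [hyI.2]

/-- An approximate limit agrees with the limit from the right, if both exist. -/
instance neBot_densityFilter_inf_right (x : ℝ) :
    NeBot (densityFilter (x : Circ) ⊓ rightFilter x) := by
  rw [inf_neBot_iff]
  intro A hA B hB
  by_contra hne
  rw [not_nonempty_iff_eq_empty] at hne
  rw [rightFilter, mem_map, mem_inf_iff] at hB
  obtain ⟨U, hU, V, hV, hUV⟩ := hB
  obtain ⟨b, hb, hbU⟩ := mem_nhdsGT_iff_exists_Ioo_subset.1 hU
  refine not_mem_densityFilter (x := x) (A := A) (δ := b - x) (sub_pos.2 hb) (Or.inl ?_) hA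
  filter_upwards [hV] with y hyV hy hyA
  have : (y : Circ) ∈ A ∩ B := ⟨hyA, by
    have : y ∈ U ∩ V := ⟨hbU ⟨hy.1, by linarith [hy.2]⟩, hyV⟩
    rwa [← hUV] at this⟩
  rw [hne] at this
  exact this

/-- An approximate limit agrees with the limit from the left, if both exist. -/
instance neBot_densityFilter_inf_left (x : ℝ) :
    NeBot (densityFilter (x : Circ) ⊓ leftFilter x) := by
  rw [inf_neBot_iff]
  intro A hA B hB
  by_contra hne
  rw [not_nonempty_iff_eq_empty] at hne
  rw [leftFilter, mem_map, mem_inf_iff] at hB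
  obtain ⟨U, hU, V, hV, hUV⟩ := hB
  obtain ⟨b, hb, hbU⟩ := mem_nhdsLT_iff_exists_Ioo_subset.1 hU
  refine not_mem_densityFilter (x := x) (A := A) (δ := x - b) (sub_pos.2 hb) (Or.inr ?_) hA
  filter_upwards [hV] with y hyV hy hyA
  have : (y : Circ) ∈ A ∩ B := ⟨hyA, by
    have : y ∈ U ∩ V := ⟨hbU ⟨by linarith [hy.1], hy.2⟩, hyV⟩
    rwa [← hUV] at this⟩
  rw [hne] at this
  exact this

lemma ae_le_densityFilter {t : Circ} {p : Circ → Prop} (h : ∀ᵐ s, p s) :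
    ∀ᶠ s in densityFilter t, p s := by
  rw [← coe_rep t]
  refine densityFilter_le _ ⟨?_, ?_⟩
  · exact (inf_le_inf_right _ nhdsWithin_le_nhds) (ae_line_of_ae_circ h (rep t))
  · exact (inf_le_inf_right _ nhdsWithin_le_nhds) (ae_line_of_ae_circ h (rep t))

lemma jumpSet_congr_ae {u v : Circ → ℝ} (h : u =ᵐ[volume] v) : jumpSet u = jumpSet v := by
  ext t
  simp only [jumpSet, mem_ofPred_eq, isApproxLimit_iff]
  refine not_congr (exists_congr fun z => tendsto_congr' ?_)
  filter_upwards [ae_le_densityFilter h] with s hs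
  rw [hs]

/-- If `u` has one-sided limits at a point, it has an approximate limit there exactly if they
agree. -/
lemma mem_jumpSet_iff_of_tendsto {u : Circ → ℝ} {x R L : ℝ}
    (hR : Tendsto u (rightFilter x) (𝓝 R)) (hL : Tendsto u (leftFilter x) (𝓝 L)) :
    (x : Circ) ∈ jumpSet u ↔ L ≠ R := by
  simp only [jumpSet, mem_ofPred_eq, isApproxLimit_iff]
  rw [not_iff_comm, not_ne_iff]
  constructor
  · rintro rfl
    refine ⟨(L : OnePoint ℝ), ?_⟩
    exact ((OnePoint.continuous_coe.tendsto L).comp (hL.sup hR)).mono_left (densityFilter_le x)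
  · rintro ⟨z, hz⟩
    have h1 : z = (R : OnePoint ℝ) := tendsto_nhds_unique
      (hz.mono_left (inf_le_left (b := rightFilter x)))
      (((OnePoint.continuous_coe.tendsto R).comp hR).mono_left inf_le_right)
    have h2 : z = (L : OnePoint ℝ) := tendsto_nhds_unique
      (hz.mono_left (inf_le_left (b := leftFilter x)))
      (((OnePoint.continuous_coe.tendsto L).comp hL).mono_left inf_le_right)
    exact OnePoint.coe_injective (h2.symm.trans h1)

lemma tendsto_signedMeasure_apply (μ : SignedMeasure Circ) {l : Filter ℝ} [l.IsCountablyGenerated]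
    {A : ℝ → Set Circ} {B : Set Circ} (hA : ∀ x, MeasurableSet (A x)) (hB : MeasurableSet B)
    (h : ∀ t, ∀ᶠ x in l, t ∈ A x ↔ t ∈ B) : Tendsto (fun x => μ (A x)) l (𝓝 (μ B)) := by
  have key : ∀ P : Measure Circ, IsFiniteMeasure P →
      Tendsto (fun x => P.real (A x)) l (𝓝 (P.real B)) := by
    intro P _
    exact (ENNReal.tendsto_toReal (measure_ne_top P B)).comp
      (tendsto_measure_of_tendsto_indicator_of_isFiniteMeasure l P hA h)
  rw [signedMeasure_apply μ hB]
  simp only [fun x => signedMeasure_apply μ (hA x)]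
  exact (key _ inferInstance).sub (key _ inferInstance)

/-- One-sided limits of a function of bounded variation. -/
lemma IsDistribDeriv.exists_tendsto {u : Circ → ℝ} {μ : SignedMeasure Circ} (hu : Integrable u)
    (h : IsDistribDeriv u μ) (t : Circ) : ∃ R : ℝ, Tendsto u (rightFilter (rep t)) (𝓝 R) ∧
      Tendsto u (leftFilter (rep t)) (𝓝 (R - μ {t})) := by
  obtain ⟨h0, c, hc⟩ := h.exists_ae_eq hu
  set x₀ := rep t with hx₀
  have hx₀m : x₀ ∈ Ioc (0 : ℝ) 1 := rep_mem t
  have hae := ae_line_of_ae_circ hc x₀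
  have hsplit : μ {s | rep s ≤ x₀} - μ {t} = μ {s | rep s < x₀} := by
    have hd : Disjoint {s | rep s < x₀} {t} := by
      rw [disjoint_singleton_right]; simp [hx₀]
    have := VectorMeasure.of_union (v := μ) hd (measurable_rep measurableSet_Iio)
      (measurableSet_singleton t)
    rw [← show {s | rep s ≤ x₀} = {s | rep s < x₀} ∪ {t} by
      ext s
      simp only [mem_ofPred_eq, mem_union, mem_singleton_iff, le_iff_lt_or_eq, hx₀]
      rw [rep_injective.eq_iff]] at this
    rw [this]; ring
  refine ⟨c + μ {s | rep s ≤ x₀}, ?_, ?_⟩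
  · refine tendsto_map'_iff.2 ?_
    have hae' : ∀ᶠ y : ℝ in 𝓝[>] x₀ ⊓ ae volume,
        u (y : Circ) = c + μ {s | rep s ≤ rep (y : Circ)} :=
      (inf_le_inf_right _ nhdsWithin_le_nhds) hae
    refine Tendsto.congr' (f₁ := fun y : ℝ => c + μ {s | rep s ≤ rep (y : Circ)})
      (hae'.mono fun y hy => hy.symm) ?_
    refine Tendsto.mono_left ?_ inf_le_left
    refine tendsto_const_nhds.add ?_
    rcases hx₀m.2.lt_or_eq with h1 | h1
    · refine Tendsto.congr' (f₁ := fun y : ℝ => μ {s | rep s ≤ y}) ?_ ?_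
      · filter_upwards [Ioo_mem_nhdsGT h1] with y hy
        rw [rep_coe ⟨hx₀m.1.trans hy.1, hy.2.le⟩]
      · refine tendsto_signedMeasure_apply μ (fun x => measurableSet_rep_le x)
          (measurableSet_rep_le x₀) (fun s => ?_)
        rcases le_or_gt (rep s) x₀ with hs | hs
        · filter_upwards [self_mem_nhdsWithin] with y hy
          exact ⟨fun _ => hs, fun _ => hs.trans (le_of_lt hy)⟩
        · filter_upwards [Ioo_mem_nhdsGT hs] with y hy
          exact ⟨fun h => absurd (hy.2.trans_le h) (lt_irrefl _),
            fun h => absurd (hs.trans_le h) (lt_irrefl _)⟩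
    · -- at the base point the distribution function restarts at `0 = μ univ`
      have hall : μ {s | rep s ≤ x₀} = μ ∅ := by
        rw [h1, show {s : Circ | rep s ≤ 1} = univ by ext s; simp [(rep_mem s).2], h0]
        simp
      rw [hall]
      refine Tendsto.congr' (f₁ := fun y : ℝ => μ {s | rep s ≤ y - 1}) ?_ ?_
      · filter_upwards [Ioo_mem_nhdsGT (show x₀ < 2 by linarith)] with y hy
        have : ((y - 1 : ℝ) : Circ) = (y : Circ) := by
          rw [AddCircle.coe_sub, sub_eq_self]; simp
        rw [← this, rep_coe ⟨by linarith [hy.1], by linarith [hy.2]⟩]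
      · refine tendsto_signedMeasure_apply μ (fun x => measurableSet_rep_le _)
          MeasurableSet.empty (fun s => ?_)
        have hs := (rep_mem s).1
        filter_upwards [Ioo_mem_nhdsGT (show x₀ < 1 + rep s by linarith)] with y hy
        simp only [mem_empty_iff_false, iff_false, not_le]
        linarith [hy.2]
  · rw [add_sub_assoc, hsplit]
    refine tendsto_map'_iff.2 ?_
    have hae' : ∀ᶠ y : ℝ in 𝓝[<] x₀ ⊓ ae volume,
        u (y : Circ) = c + μ {s | rep s ≤ rep (y : Circ)} :=
      (inf_le_inf_right _ nhdsWithin_le_nhds) hae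
    refine Tendsto.congr' (f₁ := fun y : ℝ => c + μ {s | rep s ≤ rep (y : Circ)})
      (hae'.mono fun y hy => hy.symm) ?_
    refine Tendsto.mono_left ?_ inf_le_left
    refine tendsto_const_nhds.add ?_
    refine Tendsto.congr' (f₁ := fun y : ℝ => μ {s | rep s ≤ y}) ?_ ?_
    · filter_upwards [Ioo_mem_nhdsLT hx₀m.1] with y hy
      rw [rep_coe ⟨hy.1, hy.2.le.trans hx₀m.2⟩]
    · refine tendsto_signedMeasure_apply μ (fun x => measurableSet_rep_le x)
        (measurable_rep measurableSet_Iio) (fun s => ?_)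
      rcases lt_or_ge (rep s) x₀ with hs | hs
      · filter_upwards [Ioo_mem_nhdsLT hs] with y hy
        exact ⟨fun _ => hs, fun _ => hy.1.le⟩
      · filter_upwards [self_mem_nhdsWithin] with y hy
        exact ⟨fun h => absurd ((hs.trans h).trans_lt hy) (lt_irrefl _),
          fun h => absurd (hs.trans_lt h) (lt_irrefl _)⟩

/-- The jump set of a function of bounded variation is the set of atoms of its derivative. -/
lemma IsDistribDeriv.mem_jumpSet_iff {u : Circ → ℝ} {μ : SignedMeasure Circ} (hu : Integrable u)
    (h : IsDistribDeriv u μ) (t : Circ) : t ∈ jumpSet u ↔ μ {t} ≠ 0 := by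
  obtain ⟨R, hR, hL⟩ := h.exists_tendsto hu t
  have := mem_jumpSet_iff_of_tendsto hR hL
  rw [coe_rep] at this
  rw [this]; simp

/-! ### Jumps of truncations -/

lemma trunc_abs_le (k : ℕ) (u : Circ → ℝ) (t : Circ) : |trunc k u t| ≤ k := by
  rw [abs_le, trunc]
  exact ⟨le_min (by linarith [(Nat.cast_nonneg k : (0 : ℝ) ≤ k)]) (le_max_right _ _),
    min_le_left _ _⟩

lemma tendsto_abs_of_tendsto_infty {l : Filter Circ} {u : Circ → ℝ}
    (h : Tendsto (fun s => (u s : OnePoint ℝ)) l (𝓝 OnePoint.infty)) (K : ℝ) :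
    ∀ᶠ s in l, K < |u s| := by
  have hK : (((↑) : ℝ → OnePoint ℝ) '' Icc (-K) K)ᶜ ∈ 𝓝 (OnePoint.infty : OnePoint ℝ) :=
    OnePoint.isOpen_compl_image_coe.2 ⟨isClosed_Icc, isCompact_Icc⟩ |>.mem_nhds (by simp)
  filter_upwards [h hK] with s hs
  by_contra hcon
  exact hs ⟨u s, abs_le.1 (not_lt.1 hcon), rfl⟩

lemma continuous_trunc_fun (k : ℕ) : Continuous fun y : ℝ => min (k : ℝ) (max y (-(k : ℝ))) := by
  fun_prop

/-- Truncation is continuous on `ℝ`, so it preserves finite approximate limits. It has no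
continuous extension to `ℝ ∪ {∞}`, so that a truncation may jump where the limit is `∞`. -/
lemma eq_infty_of_mem_jumpSet_trunc {k : ℕ} {u : Circ → ℝ} {t : Circ} {z : OnePoint ℝ}
    (hz : IsApproxLimit u t z) (ht : t ∈ jumpSet (trunc k u)) : z = OnePoint.infty := by
  induction z using OnePoint.rec with
  | infty => rfl
  | coe y =>
    exfalso
    apply ht
    refine ⟨((min (k : ℝ) (max y (-(k : ℝ))) : ℝ) : OnePoint ℝ), ?_⟩
    rw [isApproxLimit_iff] at hz ⊢
    have h1 : Tendsto u (densityFilter t) (𝓝 y) := by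
      exact OnePoint.isOpenEmbedding_coe.isInducing.tendsto_nhds_iff.2 hz
    exact (OnePoint.continuous_coe.tendsto _).comp
      (((continuous_trunc_fun k).tendsto y).comp h1)

/-- The jumps of all truncations lie in a set that does not depend on the height: where the
approximate limit of `u` is `∞` and the truncation at height one does not jump, the latter
determines the sign of `u` on a set of density one. -/
lemma jumpSet_trunc_subset {k : ℕ} (hk : 1 ≤ k) (u : Circ → ℝ) :
    jumpSet (trunc k u) ⊆ jumpSet u ∪ jumpSet (trunc 1 u) := by
  intro t ht
  by_contra hcon
  simp only [mem_union, not_or, jumpSet, mem_ofPred_eq, not_not] at hcon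
  obtain ⟨⟨z, hz⟩, y, hy⟩ := hcon
  obtain rfl := eq_infty_of_mem_jumpSet_trunc hz ht
  have hk1 : (1 : ℝ) ≤ k := by exact_mod_cast hk
  have hinf := tendsto_abs_of_tendsto_infty (isApproxLimit_iff.1 hz) (k : ℝ)
  rw [isApproxLimit_iff] at hy
  apply ht
  by_cases h1 : y = ((1 : ℝ) : OnePoint ℝ)
  · -- `u > k` on a set of density one
    refine ⟨((k : ℝ) : OnePoint ℝ), isApproxLimit_iff.2 (tendsto_const_nhds.congr' ?_)⟩
    have hne : {(((-1 : ℝ)) : OnePoint ℝ)}ᶜ ∈ 𝓝 y :=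
      isOpen_compl_singleton.mem_nhds (by
        rw [h1]
        simp only [mem_compl_iff, mem_singleton_iff, OnePoint.coe_eq_coe]
        norm_num)
    filter_upwards [hinf, hy hne] with s hs hs1
    have hpos : (k : ℝ) < u s := by
      rcases lt_abs.1 hs with h | h
      · exact h
      · exfalso
        apply hs1
        simp only [trunc, mem_singleton_iff, OnePoint.coe_eq_coe]
        rw [max_eq_right (by push_cast; linarith)]
        norm_num
    congr 1
    rw [trunc, max_eq_left (by linarith), min_eq_left hpos.le]
  · -- `u < -k` on a set of density one
    refine ⟨((-(k : ℝ) : ℝ) : OnePoint ℝ), isApproxLimit_iff.2 (tendsto_const_nhds.congr' ?_)⟩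
    have hne : {(((1 : ℝ)) : OnePoint ℝ)}ᶜ ∈ 𝓝 y := isOpen_compl_singleton.mem_nhds h1
    filter_upwards [hinf, hy hne] with s hs hs1
    have hneg : (k : ℝ) < -u s := by
      rcases lt_abs.1 hs with h | h
      · exfalso
        apply hs1
        simp only [trunc, mem_singleton_iff, OnePoint.coe_eq_coe]
        rw [max_eq_left (by push_cast; linarith), min_eq_left (by push_cast; linarith)]
        norm_num
      · exact h
    congr 1
    rw [trunc, max_eq_right (by linarith), min_eq_right (by linarith)]

lemma finite_atoms (μ : SignedMeasure Circ) {ε : ℝ} (hε : 0 < ε) : {t | ε ≤ |μ {t}|}.Finite := by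
  have h := Measure.finite_const_le_meas_of_disjoint_iUnion (μ.variation)
    (ε := ENNReal.ofReal ε) (by simpa using hε) (As := fun t : Circ => {t})
    (fun t => measurableSet_singleton t)
    (fun s t hst => by simpa [Function.onFun] using hst) (measure_ne_top _ _)
  refine h.subset fun t ht => ?_
  have h2 := VectorMeasure.enorm_measure_le_variation μ {t}
  refine le_trans ?_ h2
  rw [← ofReal_norm]
  exact ENNReal.ofReal_le_ofReal ht

/-- Where a truncation jumps although `u` has an approximate limit, this limit is `∞` and the
truncation jumps between its extreme values; so there are finitely many such points. -/
lemma finite_jumpSet_trunc_one_diff {u : Circ → ℝ} (h : IsBV (trunc 1 u)) :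
    (jumpSet (trunc 1 u) \ jumpSet u).Finite := by
  refine (finite_atoms (distribDeriv (trunc 1 u)) (ε := 2) (by norm_num)).subset ?_
  rintro t ⟨ht, hu⟩
  simp only [jumpSet, mem_ofPred_eq, not_not] at hu
  obtain ⟨z, hz⟩ := hu
  obtain rfl := eq_infty_of_mem_jumpSet_trunc hz ht
  have hd := h.isDistribDeriv
  obtain ⟨R, hR, hL⟩ := hd.exists_tendsto h.1 t
  have hne := (hd.mem_jumpSet_iff h.1 t).1 ht
  set a := distribDeriv (trunc 1 u) {t}
  have hval : ∀ᶠ s in densityFilter t, trunc 1 u s ∈ ({1, -1} : Set ℝ) := by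
    filter_upwards [tendsto_abs_of_tendsto_infty (isApproxLimit_iff.1 hz) 1] with s hs
    rw [trunc]
    rcases lt_abs.1 hs with h | h
    · left; rw [max_eq_left (by push_cast; linarith), min_eq_left (by push_cast; linarith)]; simp
    · right; rw [max_eq_right (by push_cast; linarith)]; simp
  have hcl : IsClosed ({1, -1} : Set ℝ) := (Set.toFinite _).isClosed
  have nR := neBot_densityFilter_inf_right (rep t)
  have nL := neBot_densityFilter_inf_left (rep t)
  rw [coe_rep] at nR nL
  have h1 : R ∈ ({1, -1} : Set ℝ) :=
    hcl.mem_of_tendsto (hR.mono_left (inf_le_right (a := densityFilter t)))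
      (hval.filter_mono inf_le_left)
  have h2 : R - a ∈ ({1, -1} : Set ℝ) :=
    hcl.mem_of_tendsto (hL.mono_left (inf_le_right (a := densityFilter t)))
      (hval.filter_mono inf_le_left)
  change 2 ≤ |a|
  rcases h1 with h1 | h1 <;> rcases h2 with h2 | h2
  · exact absurd (by linarith) hne
  · rw [show a = 2 by rw [mem_singleton_iff] at h2; linarith]; norm_num
  · rw [show a = -2 by rw [mem_singleton_iff] at h1; linarith]; norm_num
  · exact absurd (by rw [mem_singleton_iff] at h1 h2; linarith) hne

/-! ### Truncations of absolutely continuous functions -/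

/-- The truncation of real numbers at height `k`, so that `trunc k u t = clamp k (u t)` by
definition. -/
def clamp (k : ℕ) (y : ℝ) : ℝ := min (k : ℝ) (max y (-(k : ℝ)))

lemma clamp_le (k : ℕ) (y : ℝ) : clamp k y ≤ k := min_le_left _ _

lemma neg_le_clamp (k : ℕ) (y : ℝ) : -(k : ℝ) ≤ clamp k y :=
  le_min (by linarith [(Nat.cast_nonneg k : (0 : ℝ) ≤ k)]) (le_max_right _ _)

lemma clamp_of_abs_le {k : ℕ} {y : ℝ} (h : |y| ≤ k) : clamp k y = y := by
  rw [abs_le] at h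
  rw [clamp, max_eq_left h.1, min_eq_right h.2]

lemma lipschitz_clamp (k : ℕ) : LipschitzWith 1 (clamp k) :=
  (LipschitzWith.id.max_const _).const_min _

/-- The primitive, vanishing at `0`, of the lift to the real line of a function on the circle. It
is periodic only if `g` has mean value zero. -/
def prim (g : Circ → ℝ) (x : ℝ) : ℝ := ∫ y in (0 : ℝ)..x, g (y : Circ)

lemma intervalIntegrable_coe {g : Circ → ℝ} (hg : Integrable g) :
    IntervalIntegrable (fun y : ℝ => g (y : Circ)) volume 0 1 :=
  (intervalIntegrable_iff_integrableOn_Ioc_of_le zero_le_one).2 (integrable_circ_iff.1 hg)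

lemma prim_zero (g : Circ → ℝ) : prim g 0 = 0 := by simp [prim]

lemma absolutelyContinuous_clamp {g : Circ → ℝ} (hg : Integrable g) (k : ℕ) (c : ℝ) :
    AbsolutelyContinuousOnInterval (fun x => clamp k (c + prim g x)) 0 1 := by
  have h := (intervalIntegrable_coe hg).absolutelyContinuousOnInterval_intervalIntegral
    (c := 0) (by simp)
  rw [absolutelyContinuousOnInterval_iff] at h ⊢
  intro ε hε
  obtain ⟨δ, hδ, H⟩ := h ε hε
  refine ⟨δ, hδ, fun E hE hlt => lt_of_le_of_lt (Finset.sum_le_sum fun i _ => ?_) (H E hE hlt)⟩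
  refine ((lipschitz_clamp k).dist_le_mul _ _).trans ?_
  simp [prim]

/-- The chain rule for truncations: the derivative of the truncation vanishes where the truncation
attains its extreme values, since these are local extrema. -/
lemma deriv_clamp_ae {g : Circ → ℝ} (hg : Integrable g) (k : ℕ) (c : ℝ) :
    ∀ᵐ x : ℝ, x ∈ Icc (0 : ℝ) 1 → deriv (fun x => clamp k (c + prim g x)) x =
      if |c + prim g x| < k then g (x : Circ) else 0 := by
  filter_upwards [(intervalIntegrable_coe hg).ae_hasDerivAt_integral] with x hx hx01
  have hd : HasDerivAt (prim g) (g (x : Circ)) x := hx (by simpa using hx01) 0 (by simp)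
  have hd' : HasDerivAt (fun x => c + prim g x) (g (x : Circ)) x := hd.const_add c
  split_ifs with hlt
  · have : (fun x => clamp k (c + prim g x)) =ᶠ[𝓝 x] fun x => c + prim g x := by
      filter_upwards [hd'.continuousAt.abs.eventually_lt_const hlt] with y hy
      exact clamp_of_abs_le hy.le
    rw [this.deriv_eq, hd'.deriv]
  · rw [not_lt, le_abs] at hlt
    have hk : (0 : ℝ) ≤ k := Nat.cast_nonneg k
    rcases hlt with h | h
    · refine IsLocalMax.deriv_eq_zero (Eventually.of_forall fun y => ?_)
      have : clamp k (c + prim g x) = k := by rw [clamp, max_eq_left (by linarith), min_eq_left h]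
      dsimp only
      rw [this]
      exact clamp_le _ _
    · refine IsLocalMin.deriv_eq_zero (Eventually.of_forall fun y => ?_)
      have : clamp k (c + prim g x) = -k := by
        rw [clamp, max_eq_right (by linarith), min_eq_right (by linarith)]
      dsimp only
      rw [this]
      exact neg_le_clamp _ _

lemma sum_signedMeasure_apply {ι : Type*} (s : Finset ι) (ν : ι → SignedMeasure Circ)
    (E : Set Circ) : (∑ i ∈ s, ν i) E = ∑ i ∈ s, ν i E := by
  classical
  induction s using Finset.induction_on with
  | empty => simp
  | insert i s hi ih => rw [Finset.sum_insert hi, Finset.sum_insert hi, _root_.add_apply, ih]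

instance : NullSingletonClass (volume : Measure Circ) where
  measure_singleton t := by
    rw [← Metric.closedBall_zero, AddCircle.volume_closedBall]
    simp

/-! ### Piecewise absolutely continuous functions -/

/-- On each interval `(τ j, τ (j + 1))` of the partition `0 = τ 0 ≤ τ 1 ≤ ⋯ ≤ τ (p + 1) = 1` the
function `u` is `c j` plus the primitive of `g`. The base point `0` of the circle is not counted
among the `p` jump points; unless it is one of `τ 1, …, τ p`, the first and the last piece are
required to match there. -/
structure IsPiecewise (p : ℕ) (τ c : ℕ → ℝ) (g u : Circ → ℝ) : Prop where
  mono : Monotone τ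
  zero : τ 0 = 0
  last : τ (p + 1) = 1
  int : Integrable g
  eq : ∀ j ≤ p, ∀ᵐ x : ℝ, x ∈ Ioo (τ j) (τ (j + 1)) → u (x : Circ) = c j + prim g x
  glue : (∀ j, 1 ≤ j → j ≤ p → ((τ j : ℝ) : Circ) ≠ 0) → c p + prim g 1 = c 0

namespace IsPiecewise

variable {p : ℕ} {τ c : ℕ → ℝ} {g u : Circ → ℝ}

lemma mem_Icc (h : IsPiecewise p τ c g u) {j : ℕ} (hj : j ≤ p + 1) : τ j ∈ Icc (0 : ℝ) 1 :=
  ⟨h.zero ▸ h.mono (Nat.zero_le j), h.last ▸ h.mono hj⟩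

/-- Almost every point lies in one of the open pieces. -/
lemma ae_of_forall (h : IsPiecewise p τ c g u) {P : ℝ → Prop}
    (hP : ∀ j ≤ p, ∀ᵐ x : ℝ, x ∈ Ioo (τ j) (τ (j + 1)) → P x) :
    ∀ᵐ x ∂(volume.restrict (Ioc (0 : ℝ) 1)), P x := by
  rw [ae_restrict_iff' measurableSet_Ioc]
  have h1 : ∀ᵐ x : ℝ, ∀ j, j ≤ p → x ∈ Ioo (τ j) (τ (j + 1)) → P x :=
    ae_all_iff.2 fun j => by
      by_cases hj : j ≤ p
      · filter_upwards [hP j hj] with x hx _ using hx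
      · exact Eventually.of_forall fun x h => absurd h hj
  have h2 : ∀ᵐ x : ℝ, ∀ j, x ≠ τ j := ae_all_iff.2 fun j => by
    exact compl_mem_ae_iff.2 (measure_singleton (τ j))
  filter_upwards [h1, h2] with x hx hxτ hx01
  have hlt : x < τ (p + 1) := by
    rw [h.last]
    exact lt_of_le_of_ne hx01.2 (h.last ▸ hxτ (p + 1))
  have hex : ∃ n, x < τ (n + 1) := ⟨p, hlt⟩
  classical
  have hj := Nat.find_spec hex
  have hjp : Nat.find hex ≤ p := Nat.find_min' hex hlt
  refine hx _ hjp ⟨?_, hj⟩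
  rcases Nat.eq_zero_or_pos (Nat.find hex) with h0 | h0
  · rw [h0, h.zero]; exact hx01.1
  · have := Nat.find_min hex (Nat.sub_lt h0 one_pos)
    rw [Nat.sub_add_cancel (n := Nat.find hex) (m := 1) h0, not_lt] at this
    exact lt_of_le_of_ne this (hxτ _).symm

/-- The absolutely continuous part of the derivative of the truncation at height `k`. -/
def truncDensity (k : ℕ) (g u : Circ → ℝ) (t : Circ) : ℝ := if |u t| < k then g t else 0

/-- The jump part of the derivative of the truncation at height `k`: the boundary terms of an
integration by parts on each piece. The terms at `τ 0 = 0` and at `τ (p + 1) = 1` belong to the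
same point of the circle. -/
def jumpMeasure (p : ℕ) (τ c : ℕ → ℝ) (g : Circ → ℝ) (k : ℕ) : SignedMeasure Circ :=
  ∑ j ∈ Finset.range (p + 1),
    (VectorMeasure.dirac ((τ j : ℝ) : Circ) (clamp k (c j + prim g (τ j))) -
      VectorMeasure.dirac ((τ (j + 1) : ℝ) : Circ) (clamp k (c j + prim g (τ (j + 1)))))

lemma integrable_truncDensity (h : IsPiecewise p τ c g u) (hu : Measurable u) (k : ℕ) :
    Integrable (truncDensity k g u) := by
  have hm : MeasurableSet {t | |u t| < k} := measurableSet_lt (by fun_prop) measurable_const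
  refine (h.int.indicator hm).congr (Eventually.of_forall fun t => ?_)
  simp [indicator, truncDensity]

lemma vintegral_jumpMeasure {φ : Circ → ℝ} (hφ : Continuous φ) (k : ℕ) :
    ∫ᵛ t, φ t ∂•(jumpMeasure p τ c g k) = ∑ j ∈ Finset.range (p + 1),
      (φ (τ j : ℝ) * clamp k (c j + prim g (τ j)) -
        φ (τ (j + 1) : ℝ) * clamp k (c j + prim g (τ (j + 1)))) := by
  rw [jumpMeasure, VectorMeasure.integral_finsetSum_vectorMeasure
    (fun j _ => integrable_of_continuous hφ _)]
  refine Finset.sum_congr rfl fun j _ => ?_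
  rw [VectorMeasure.integral_sub_vectorMeasure (integrable_of_continuous hφ _)
    (integrable_of_continuous hφ _), VectorMeasure.integral_dirac, VectorMeasure.integral_dirac]
  simp

/-- Integration by parts on each piece. -/
lemma isDistribDeriv_trunc (h : IsPiecewise p τ c g u) (hu : Measurable u) (k : ℕ) :
    IsDistribDeriv (trunc k u)
      (volume.withDensityᵥ (truncDensity k g u) + jumpMeasure p τ c g k) := by
  intro φ hφ
  have hint := h.integrable_truncDensity hu k
  rw [VectorMeasure.integral_add_vectorMeasure (integrable_of_continuous hφ.continuous _)
    (integrable_of_continuous hφ.continuous _), vintegral_withDensity hint hφ.continuous,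
    vintegral_jumpMeasure hφ.continuous]
  set f : ℝ → ℝ := fun x => φ (x : Circ) with hf
  have hfd : ContDiff ℝ 1 f := ContDiff.of_le hφ (by simp)
  have hf' : Continuous (deriv f) := hfd.continuous_deriv le_rfl
  have hfc : Continuous f := hfd.continuous
  rw [integral_circ, integral_circ]
  simp only [circleDeriv_coe]
  change ∫ x in (0 : ℝ)..1, trunc k u (x : Circ) * deriv f x = _
  have hsub : ∀ j ≤ p, uIcc (τ j) (τ (j + 1)) ⊆ uIcc (0 : ℝ) 1 := fun j hj => by
    rw [uIcc_of_le (zero_le_one' ℝ)]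
    exact uIcc_subset_Icc (h.mem_Icc (by omega)) (h.mem_Icc (by omega))
  have hI1 : IntervalIntegrable (fun x : ℝ => trunc k u (x : Circ) * deriv f x) volume 0 1 := by
    rw [intervalIntegrable_iff_integrableOn_Ioc_of_le zero_le_one]
    refine (((intervalIntegrable_iff_integrableOn_Ioc_of_le zero_le_one).1
      (hf'.intervalIntegrable 0 1)).bdd_mul (c := k) ?_ (Eventually.of_forall fun x => ?_))
    · refine Measurable.aestronglyMeasurable ?_
      exact ((continuous_trunc_fun k).measurable.comp hu).comp measurable_coe_circ
    · rw [Real.norm_eq_abs]; exact trunc_abs_le _ _ _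
  have hI2 : IntervalIntegrable (fun x : ℝ => φ (x : Circ) * truncDensity k g u (x : Circ))
      volume 0 1 := (intervalIntegrable_coe hint).continuousOn_mul hfc.continuousOn
  have e1 : ∫ x in (0 : ℝ)..1, trunc k u (x : Circ) * deriv f x =
      ∑ j ∈ Finset.range (p + 1), ∫ x in τ j..τ (j + 1), trunc k u (x : Circ) * deriv f x := by
    rw [intervalIntegral.sum_integral_adjacent_intervals, h.zero, h.last]
    exact fun j hj => hI1.mono_set (hsub j (by omega))
  have e2 : ∫ x in (0 : ℝ)..1, φ (x : Circ) * truncDensity k g u (x : Circ) =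
      ∑ j ∈ Finset.range (p + 1), ∫ x in τ j..τ (j + 1),
        φ (x : Circ) * truncDensity k g u (x : Circ) := by
    rw [intervalIntegral.sum_integral_adjacent_intervals, h.zero, h.last]
    exact fun j hj => hI2.mono_set (hsub j (by omega))
  rw [e1, e2, ← Finset.sum_add_distrib, ← Finset.sum_neg_distrib]
  refine Finset.sum_congr rfl fun j hj => ?_
  have hjp : j ≤ p := by simpa [Nat.lt_succ_iff] using hj
  set W : ℝ → ℝ := fun x => clamp k (c j + prim g x) with hW
  have hAC : AbsolutelyContinuousOnInterval W (τ j) (τ (j + 1)) :=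
    (absolutelyContinuous_clamp h.int k (c j)).mono (hsub j hjp)
  have hACf : AbsolutelyContinuousOnInterval f (τ j) (τ (j + 1)) :=
    hfd.contDiffOn.absolutelyContinuousOnInterval
  have hle : τ j ≤ τ (j + 1) := h.mono (Nat.le_succ j)
  have hne : ∀ᵐ x : ℝ, x ≠ τ (j + 1) := compl_mem_ae_iff.2 (measure_singleton _)
  have i1 : ∫ x in τ j..τ (j + 1), trunc k u (x : Circ) * deriv f x =
      ∫ x in τ j..τ (j + 1), W x * deriv f x := by
    refine intervalIntegral.integral_congr_ae ?_
    filter_upwards [h.eq j hjp, hne] with x hx hx1 hxI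
    rw [uIoc_of_le hle] at hxI
    rw [trunc, hx ⟨hxI.1, lt_of_le_of_ne hxI.2 hx1⟩]
    rfl
  have i2 : ∫ x in τ j..τ (j + 1), φ (x : Circ) * truncDensity k g u (x : Circ) =
      ∫ x in τ j..τ (j + 1), deriv W x * f x := by
    refine intervalIntegral.integral_congr_ae ?_
    filter_upwards [h.eq j hjp, hne, deriv_clamp_ae h.int k (c j)] with x hx hx1 hxd hxI
    have hx01 : x ∈ Icc (0 : ℝ) 1 := by
      have := hsub j hjp (uIoc_subset_uIcc hxI)
      simpa using this
    rw [uIoc_of_le hle] at hxI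
    rw [hW, hxd hx01, truncDensity, hx ⟨hxI.1, lt_of_le_of_ne hxI.2 hx1⟩, mul_comm]
  rw [i1, i2, hAC.integral_mul_deriv_eq_deriv_mul hACf]
  simp only [hf, hW]
  ring

open Classical in
/-- The points of the partition, as a finite subset of the circle. -/
def nodes (p : ℕ) (τ : ℕ → ℝ) : Finset Circ :=
  (Finset.range (p + 2)).image fun j => ((τ j : ℝ) : Circ)

lemma jumpMeasure_eq_zero {k : ℕ} {E : Set Circ} (hE : ∀ t ∈ nodes p τ, t ∉ E) :
    jumpMeasure p τ c g k E = 0 := by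
  classical
  rw [jumpMeasure, sum_signedMeasure_apply]
  refine Finset.sum_eq_zero fun j hj => ?_
  rw [Finset.mem_range] at hj
  rw [_root_.sub_apply, VectorMeasure.dirac_apply_of_notMem,
    VectorMeasure.dirac_apply_of_notMem, sub_zero]
  · exact hE _ (Finset.mem_image.2 ⟨j + 1, by simp; omega, rfl⟩)
  · exact hE _ (Finset.mem_image.2 ⟨j, by simp; omega, rfl⟩)

end IsPiecewise

open Classical in
/-- A signed measure carried by a finite set is the sum of its atoms. -/
lemma apply_eq_sum_of_finite (ν : SignedMeasure Circ) (F : Finset Circ)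
    (hF : ∀ E, (∀ t ∈ F, t ∉ E) → ν E = 0) {E : Set Circ} (hE : MeasurableSet E) :
    ν E = ∑ t ∈ F, if t ∈ E then ν {t} else 0 := by
  have hFE : MeasurableSet (⋃ t ∈ F.filter (· ∈ E), ({t} : Set Circ)) :=
    Finset.measurableSet_biUnion _ fun t _ => measurableSet_singleton t
  have hsub : (⋃ t ∈ F.filter (· ∈ E), ({t} : Set Circ)) ⊆ E := by
    intro t ht
    simp only [mem_iUnion, mem_singleton_iff, exists_prop, exists_eq_right',
      Finset.mem_filter] at ht
    exact ht.2
  have h1 := VectorMeasure.of_add_of_sdiff (v := ν) hFE hE hsub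
  rw [← h1, hF (E \ _), add_zero, VectorMeasure.of_biUnion_finset, Finset.sum_filter]
  · intro s _ t _ hst
    simpa [Function.onFun] using hst
  · exact fun t _ => measurableSet_singleton t
  · intro t ht hmem
    refine hmem.2 ?_
    simp only [mem_iUnion, mem_singleton_iff, exists_prop, exists_eq_right', Finset.mem_filter]
    exact ⟨ht, hmem.1⟩

lemma mutuallySingular_of_finite (ν : SignedMeasure Circ) (F : Finset Circ)
    (hF : ∀ E, (∀ t ∈ F, t ∉ E) → ν E = 0) :
    ν ⟂ᵥ (volume : Measure Circ).toENNRealVectorMeasure := by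
  refine ⟨(F : Set Circ)ᶜ, F.measurableSet.compl, fun E hE => hF E fun t ht hmem => hE hmem ht,
    fun E hE => ?_⟩
  rw [compl_compl] at hE
  have hfin : E.Finite := F.finite_toSet.subset hE
  rw [Measure.toENNRealVectorMeasure_apply_measurable hfin.measurableSet, hfin.measure_zero]

namespace IsPiecewise

variable {p : ℕ} {τ c : ℕ → ℝ} {g u : Circ → ℝ}

lemma integrable_trunc (hu : Measurable u) (k : ℕ) : Integrable (trunc k u) :=
  Integrable.of_bound ((continuous_trunc_fun k).measurable.comp hu).aestronglyMeasurable k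
    (Eventually.of_forall fun t => by rw [Real.norm_eq_abs]; exact trunc_abs_le k u t)

lemma jumpMeasure_mutuallySingular (k : ℕ) :
    jumpMeasure p τ c g k ⟂ᵥ (volume : Measure Circ).toENNRealVectorMeasure :=
  mutuallySingular_of_finite _ (nodes p τ) fun _ hE => jumpMeasure_eq_zero hE

lemma withDensity_singleton {h : Circ → ℝ} (hh : Integrable h) (t : Circ) :
    volume.withDensityᵥ h {t} = 0 := by
  rw [withDensityᵥ_apply hh (measurableSet_singleton t)]
  exact setIntegral_measure_zero _ (measure_singleton t)

lemma mem_jumpSet_trunc_iff (h : IsPiecewise p τ c g u) (hu : Measurable u) (k : ℕ) (t : Circ) :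
    t ∈ jumpSet (trunc k u) ↔ jumpMeasure p τ c g k {t} ≠ 0 := by
  rw [(h.isDistribDeriv_trunc hu k).mem_jumpSet_iff (integrable_trunc hu k) t,
    _root_.add_apply, withDensity_singleton (h.integrable_truncDensity hu k), zero_add]

lemma isSBV_trunc (h : IsPiecewise p τ c g u) (hu : Measurable u) (k : ℕ) :
    IsSBV (trunc k u) := by
  refine ⟨⟨integrable_trunc hu k, _, h.isDistribDeriv_trunc hu k⟩, fun E hE hES => ?_⟩
  rw [(h.isDistribDeriv_trunc hu k).distribDeriv_eq,
    ← SignedMeasure.eq_singularPart _ _ (jumpMeasure_mutuallySingular k) (add_comm _ _),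
    apply_eq_sum_of_finite _ (nodes p τ) (fun _ hE => jumpMeasure_eq_zero hE) hE]
  refine Finset.sum_eq_zero fun t _ => ?_
  split_ifs with ht
  · by_contra hne
    exact hES ht ((h.mem_jumpSet_trunc_iff hu k t).2 hne)
  · rfl

lemma rnDeriv_trunc (h : IsPiecewise p τ c g u) (hu : Measurable u) (k : ℕ) :
    (distribDeriv (trunc k u)).rnDeriv volume =ᵐ[volume] truncDensity k g u := by
  rw [(h.isDistribDeriv_trunc hu k).distribDeriv_eq]
  exact (SignedMeasure.eq_rnDeriv _ _ (h.integrable_truncDensity hu k)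
    (jumpMeasure_mutuallySingular k) (add_comm _ _)).symm

lemma isGSBV (h : IsPiecewise p τ c g u) (hu : Measurable u) : IsGSBV u :=
  ⟨hu, h.isSBV_trunc hu⟩

lemma approxGradient_ae_eq (h : IsPiecewise p τ c g u) (hu : Measurable u) :
    approxGradient u =ᵐ[volume] g := by
  have hall : ∀ᵐ t, ∀ k, (distribDeriv (trunc k u)).rnDeriv volume t = truncDensity k g u t :=
    ae_all_iff.2 fun k => h.rnDeriv_trunc hu k
  filter_upwards [hall] with t ht
  rw [approxGradient, ht, truncDensity, if_pos]
  push_cast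
  exact Nat.lt_floor_add_one _

lemma ae_abs_le (h : IsPiecewise p τ c g u) : ∃ k : ℕ, ∀ᵐ t, |u t| ≤ k := by
  set B := ∑ j ∈ Finset.range (p + 1), |c j| + ∫ x in (0 : ℝ)..1, |g (x : Circ)|
  obtain ⟨k, hk⟩ := exists_nat_ge B
  refine ⟨k, ?_⟩
  rw [ae_circ_iff]
  refine h.ae_of_forall fun j hj => ?_
  filter_upwards [h.eq j hj] with x hx hxI
  rw [hx hxI]
  refine le_trans ?_ hk
  refine (abs_add_le _ _).trans (add_le_add ?_ ?_)
  · exact Finset.single_le_sum (f := fun j => |c j|) (fun i _ => abs_nonneg _)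
      (Finset.mem_range.2 (by omega))
  · have h0 : 0 ≤ x := ((h.mem_Icc (j := j) (by omega)).1.trans_lt hxI.1).le
    have h1 : x ≤ 1 := hxI.2.le.trans (h.mem_Icc (j := j + 1) (by omega)).2
    refine (intervalIntegral.abs_integral_le_integral_abs h0).trans ?_
    exact intervalIntegral.integral_mono_interval le_rfl h0 h1
      (Eventually.of_forall fun y => abs_nonneg _) (intervalIntegrable_coe h.int).abs

lemma trunc_ae_eq {k : ℕ} (hk : ∀ᵐ t, |u t| ≤ k) : trunc k u =ᵐ[volume] u := by
  filter_upwards [hk] with t ht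
  exact clamp_of_abs_le ht

lemma jumpSet_subset (h : IsPiecewise p τ c g u) (hu : Measurable u) :
    jumpSet u ⊆ (fun j => ((τ j : ℝ) : Circ)) '' Icc 1 p := by
  obtain ⟨k, hk⟩ := h.ae_abs_le
  rw [← jumpSet_congr_ae (trunc_ae_eq hk)]
  intro t ht
  rw [h.mem_jumpSet_trunc_iff hu k] at ht
  by_contra hmem
  have hτ : ∀ j, 1 ≤ j → j ≤ p → ((τ j : ℝ) : Circ) ≠ t := fun j h1 h2 heq =>
    hmem ⟨j, ⟨h1, h2⟩, heq⟩
  have h1z : ((1 : ℝ) : Circ) = 0 := by simp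
  have h0z : ((0 : ℝ) : Circ) = 0 := by simp
  apply ht
  have hap : ∀ (x : ℝ) (v : ℝ), VectorMeasure.dirac ((x : ℝ) : Circ) v {t} =
      if (x : Circ) = t then v else 0 := by
    intro x v
    split_ifs with hxt
    · exact VectorMeasure.dirac_apply_of_mem (measurableSet_singleton t) hxt
    · exact VectorMeasure.dirac_apply_of_notMem hxt
  simp only [jumpMeasure, sum_signedMeasure_apply, _root_.sub_apply, hap]
  rw [Finset.sum_sub_distrib, Finset.sum_range_succ', Finset.sum_range_succ _ p,
    Finset.sum_eq_zero, Finset.sum_eq_zero, h.zero, h.last, h0z, h1z, zero_add, zero_add]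
  · -- at the base point the contributions of the first and the last piece cancel
    by_cases ht0 : (0 : Circ) = t
    · subst ht0
      rw [if_pos rfl, if_pos rfl, h.glue hτ, prim_zero, add_zero, sub_self]
    · rw [if_neg ht0, if_neg ht0, sub_self]
  · exact fun j hj => if_neg (hτ _ (by omega) (by rw [Finset.mem_range] at hj; omega))
  · exact fun j hj => if_neg (hτ _ (by omega) (by rw [Finset.mem_range] at hj; omega))

lemma MS_le (h : IsPiecewise p τ c g u) (hu : Measurable u) :
    MS u (fun _ => 1) ≤ (∫⁻ t, ‖g t‖ₑ ^ 2) + p := by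
  rw [MS, if_pos ⟨h.isGSBV hu, EventuallyEq.rfl⟩]
  refine add_le_add (le_of_eq ?_) ?_
  · refine lintegral_congr_ae ?_
    filter_upwards [h.approxGradient_ae_eq hu] with t ht
    rw [ht]
  · have h1 : (jumpSet u).encard ≤ p := by
      refine (encard_le_encard (h.jumpSet_subset hu)).trans ((encard_image_le _ _).trans ?_)
      rw [← Finset.coe_Icc, encard_coe_eq_coe_finsetCard]
      simp
    calc ((jumpSet u).encard : ℝ≥0∞) ≤ ((p : ℕ∞) : ℝ≥0∞) := by exact_mod_cast h1
      _ = p := by simp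

end IsPiecewise

/-! ### The structure of functions of finite energy -/

/-- The points of a finite subset of the circle, in increasing order of their representatives in
`(0, 1]`, completed to a partition of the unit interval. -/
lemma exists_partition (F : Finset Circ) : ∃ τ : ℕ → ℝ, Monotone τ ∧ τ 0 = 0 ∧
    (∀ j, F.card + 1 ≤ j → τ j = 1) ∧ (∀ t ∈ F, ∃ j, 1 ≤ j ∧ j ≤ F.card ∧ rep t = τ j) := by
  classical
  have hR : (F.image rep).card = F.card := Finset.card_image_of_injective _ rep_injective
  set e := (F.image rep).orderEmbOfFin hR with he
  have hmem : ∀ i, e i ∈ Ioc (0 : ℝ) 1 := by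
    intro i
    obtain ⟨t, -, ht⟩ := Finset.mem_image.1 ((F.image rep).orderEmbOfFin_mem hR i)
    rw [he, ← ht]; exact rep_mem t
  set τ : ℕ → ℝ := fun j => if h : 1 ≤ j ∧ j ≤ F.card then e ⟨j - 1, by omega⟩ else
    if j = 0 then 0 else 1 with hτ
  refine ⟨τ, ?_, by simp [hτ], ?_, ?_⟩
  · refine monotone_nat_of_le_succ fun j => ?_
    simp only [hτ]
    by_cases h1 : 1 ≤ j ∧ j ≤ F.card
    · rw [dif_pos h1]
      by_cases h2 : j + 1 ≤ F.card
      · rw [dif_pos ⟨by omega, h2⟩]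
        exact e.monotone (by simp)
      · rw [dif_neg (by omega), if_neg (by omega)]
        exact (hmem _).2
    · rw [dif_neg h1]
      by_cases h2 : 1 ≤ j + 1 ∧ j + 1 ≤ F.card
      · rw [dif_pos h2, if_pos (by omega)]
        exact (hmem _).1.le
      · rw [dif_neg h2, if_neg (Nat.succ_ne_zero j)]
        split_ifs <;> simp
  · intro j hj
    simp only [hτ]
    rw [dif_neg (by omega), if_neg (by omega)]
  · intro t ht
    have : rep t ∈ range e := by
      rw [he, Finset.range_orderEmbOfFin]
      exact Finset.mem_coe.2 (Finset.mem_image_of_mem _ ht)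
    obtain ⟨i, hi⟩ := this
    refine ⟨i + 1, by omega, by omega, ?_⟩
    simp only [hτ]
    rw [dif_pos ⟨by omega, by omega⟩, ← hi]
    rfl

/-- A special function of bounded variation with finitely many jumps is piecewise absolutely
continuous. -/
lemma IsSBV.exists_isPiecewise {v : Circ → ℝ} (hv : IsSBV v) {F : Finset Circ}
    (hF : jumpSet v ⊆ F) {τ : ℕ → ℝ} (hmono : Monotone τ) (h0 : τ 0 = 0)
    (h1 : ∀ j, F.card + 1 ≤ j → τ j = 1)
    (hτF : ∀ t ∈ F, ∃ j, 1 ≤ j ∧ j ≤ F.card ∧ rep t = τ j) :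
    ∃ c : ℕ → ℝ, IsPiecewise F.card τ c ((distribDeriv v).rnDeriv volume) v := by
  classical
  obtain ⟨huniv, c₀, hc₀⟩ := hv.1.isDistribDeriv.exists_ae_eq hv.1.1
  set μ := distribDeriv v
  set σ := μ.singularPart volume
  set g := μ.rnDeriv volume
  have hg : Integrable g := SignedMeasure.integrable_rnDeriv _ _
  have hσ : ∀ E, (∀ t ∈ F, t ∉ E) → σ E = 0 := by
    intro E hE
    by_cases hm : MeasurableSet E
    · exact hv.2 E hm fun t ht hmem => hE t (hF hmem) ht
    · exact VectorMeasure.not_measurable _ hm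
  have hμ : ∀ x ∈ Icc (0 : ℝ) 1, μ {s | rep s ≤ x} =
      (∑ t ∈ F, if rep t ≤ x then σ {t} else 0) + prim g x := by
    intro x hx
    conv_lhs => rw [← SignedMeasure.singularPart_add_withDensity_rnDeriv_eq (s := μ)
      (μ := (volume : Measure Circ))]
    rw [_root_.add_apply, withDensityᵥ_apply hg (measurableSet_rep_le x), setIntegral_rep_le hx,
      apply_eq_sum_of_finite σ F hσ (measurableSet_rep_le x)]
    rfl
  refine ⟨fun j => c₀ + ∑ t ∈ F, if rep t ≤ τ j then σ {t} else 0, hmono, h0, h1 _ le_rfl, hg,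
    ?_, ?_⟩
  · intro j hj
    have h01 : ∀ i, τ i ∈ Icc (0 : ℝ) 1 := fun i =>
      ⟨h0 ▸ hmono (Nat.zero_le i), by
        rw [← h1 (max i (F.card + 1)) (le_max_right _ _)]
        exact hmono (le_max_left _ _)⟩
    rw [ae_circ_iff, ae_restrict_iff' measurableSet_Ioc] at hc₀
    filter_upwards [hc₀] with x hx hxI
    have hx01 : x ∈ Ioc (0 : ℝ) 1 := ⟨(h01 j).1.trans_lt hxI.1, hxI.2.le.trans (h01 _).2⟩
    rw [hx hx01, rep_coe hx01, hμ x (Ioc_subset_Icc_self hx01), add_assoc]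
    congr 2
    refine Finset.sum_congr rfl fun t ht => if_congr ?_ rfl rfl
    obtain ⟨i, -, -, hi⟩ := hτF t ht
    rw [hi]
    constructor
    · intro hle
      refine hmono ?_
      by_contra hij
      have := hmono (show j + 1 ≤ i by omega)
      linarith [hxI.2]
    · intro hle
      exact hle.trans hxI.1.le
  · intro _
    have hone := hμ 1 (by simp)
    rw [show {s : Circ | rep s ≤ 1} = univ by ext s; simp [(rep_mem s).2], huniv] at hone
    have e1 : ∑ t ∈ F, (if rep t ≤ τ F.card then σ {t} else 0) =
        ∑ t ∈ F, if rep t ≤ 1 then σ {t} else 0 := by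
      refine Finset.sum_congr rfl fun t ht => ?_
      obtain ⟨i, -, hi2, hi⟩ := hτF t ht
      rw [if_pos (by rw [hi]; exact hmono hi2), if_pos (rep_mem t).2]
    have e2 : ∑ t ∈ F, (if rep t ≤ τ 0 then σ {t} else 0) = 0 := by
      refine Finset.sum_eq_zero fun t _ => if_neg ?_
      rw [h0, not_le]
      exact (rep_mem t).1
    simp only [e1, e2]
    linarith

lemma IsPiecewise.congr_ae {p : ℕ} {τ c : ℕ → ℝ} {g u v : Circ → ℝ} (h : IsPiecewise p τ c g u)
    (huv : u =ᵐ[volume] v) : IsPiecewise p τ c g v where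
  mono := h.mono
  zero := h.zero
  last := h.last
  int := h.int
  glue := h.glue
  eq := by
    intro j hj
    have := ae_circ_iff.1 huv
    rw [ae_restrict_iff' measurableSet_Ioc] at this
    filter_upwards [h.eq j hj, this] with x hx hx2 hxI
    rw [← hx2 ⟨(h.mem_Icc (j := j) (by omega)).1.trans_lt hxI.1,
      hxI.2.le.trans (h.mem_Icc (j := j + 1) (by omega)).2⟩, hx hxI]

lemma abs_clamp_lt_iff {j k : ℕ} (hjk : j ≤ k) (y : ℝ) : |clamp k y| < j ↔ |y| < j := by
  have hjk' : (j : ℝ) ≤ k := by exact_mod_cast hjk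
  by_cases h : |y| ≤ k
  · rw [clamp_of_abs_le h]
  · rw [not_le] at h
    have h2 : |clamp k y| = k := by
      have hk : (0 : ℝ) ≤ k := Nat.cast_nonneg k
      rcases lt_abs.1 h with h | h
      · rw [clamp, max_eq_left (by linarith), min_eq_left h.le, abs_of_nonneg hk]
      · rw [clamp, max_eq_right (by linarith), min_eq_right (by linarith), abs_neg,
          abs_of_nonneg hk]
    rw [h2]
    constructor <;> intro h3 <;> linarith

lemma clamp_clamp {j k : ℕ} (hjk : j ≤ k) (y : ℝ) : clamp j (clamp k y) = clamp j y := by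
  have hjk' : (j : ℝ) ≤ k := by exact_mod_cast hjk
  have hj : (0 : ℝ) ≤ j := Nat.cast_nonneg j
  simp only [clamp]
  rcases le_total y (-k) with h | h
  · have hk : -(k : ℝ) ≤ -(j : ℝ) := neg_le_neg hjk'
    rw [max_eq_right h, min_eq_right (show -(k : ℝ) ≤ k by linarith), max_eq_right hk,
      max_eq_right (h.trans hk)]
  · rw [max_eq_left h]
    rcases le_total (k : ℝ) y with h2 | h2
    · rw [min_eq_left h2, max_eq_left (by linarith), max_eq_left (by linarith),
        min_eq_left hjk', min_eq_left (by linarith)]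
    · rw [min_eq_right h2]

lemma abs_prim_le {g : Circ → ℝ} (hg : Integrable g) {x : ℝ} (hx : x ∈ Icc (0 : ℝ) 1) :
    |prim g x| ≤ ∫ t, |g t| := by
  rw [integral_circ]
  refine (intervalIntegral.abs_integral_le_integral_abs hx.1).trans ?_
  exact intervalIntegral.integral_mono_interval le_rfl hx.1 hx.2
    (Eventually.of_forall fun y => abs_nonneg _) (intervalIntegrable_coe hg).abs

lemma lintegral_enorm_le_one_add (g : Circ → ℝ) : ∫⁻ t, ‖g t‖ₑ ≤ 1 + ∫⁻ t, ‖g t‖ₑ ^ 2 := by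
  calc ∫⁻ t, ‖g t‖ₑ ≤ ∫⁻ t, (1 + ‖g t‖ₑ ^ 2) := by
        refine lintegral_mono fun t => ?_
        rcases le_total ‖g t‖ₑ 1 with h | h
        · exact h.trans le_self_add
        · calc ‖g t‖ₑ = ‖g t‖ₑ * 1 := (mul_one _).symm
            _ ≤ ‖g t‖ₑ * ‖g t‖ₑ := by gcongr
            _ = ‖g t‖ₑ ^ 2 := (sq _).symm
            _ ≤ _ := le_add_self
    _ = _ := by rw [lintegral_add_left measurable_const]; simp

/-- A function of finite Mumford–Shah energy is piecewise absolutely continuous, with the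
discontinuity set as its set of nodes. Its truncations are so by `IsSBV.exists_isPiecewise`; as
their gradients are bounded by that of `u`, their oscillation on the pieces is bounded uniformly
in the height, so that `u` is bounded and agrees with one of its truncations. -/
theorem exists_isPiecewise_of_MS_ne_top {u : Circ → ℝ} (h : MS u (fun _ => 1) ≠ ⊤) :
    ∃ (p : ℕ) (τ c : ℕ → ℝ) (g : Circ → ℝ), IsPiecewise p τ c g u ∧
      (∀ j, p + 1 ≤ j → τ j = 1) ∧ Measurable g ∧
      MS u (fun _ => 1) = (∫⁻ t, ‖g t‖ₑ ^ 2) + p := by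
  have hG : IsGSBV u := by
    by_contra hcon
    exact h (if_neg fun hh => hcon hh.1)
  have hMS : MS u (fun _ => 1) = (∫⁻ t, ‖approxGradient u t‖ₑ ^ 2) + ((jumpSet u).encard : ℝ≥0∞) :=
    if_pos ⟨hG, EventuallyEq.rfl⟩
  rw [hMS] at h
  have hM : (∫⁻ t, ‖approxGradient u t‖ₑ ^ 2) ≠ ⊤ := fun hh => h (by rw [hh]; simp)
  have hS : (jumpSet u).Finite := by
    rw [← encard_ne_top_iff]
    intro hh
    exact h (by rw [hh]; simp)
  obtain ⟨hu, hT⟩ := hG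
  -- the nodes of all truncations lie in a fixed finite set
  have hF1 : (jumpSet u ∪ jumpSet (trunc 1 u)).Finite := by
    rw [← union_sdiff_self]
    exact hS.union (finite_jumpSet_trunc_one_diff (hT 1).1)
  set F := hF1.toFinset with hF
  have hFk : ∀ k, 1 ≤ k → jumpSet (trunc k u) ⊆ F := by
    intro k hk
    rw [hF, Finite.coe_toFinset]
    exact jumpSet_trunc_subset hk u
  obtain ⟨τ, hmono, h0, h1, hτF⟩ := exists_partition F
  set g : ℕ → Circ → ℝ := fun k => (distribDeriv (trunc k u)).rnDeriv volume with hg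
  have hpw : ∀ k, ∃ c : ℕ → ℝ, 1 ≤ k → IsPiecewise F.card τ c (g k) (trunc k u) := by
    intro k
    by_cases hk : 1 ≤ k
    · obtain ⟨c, hc⟩ := (hT k).exists_isPiecewise (hFk k hk) hmono h0 h1 hτF
      exact ⟨c, fun _ => hc⟩
    · exact ⟨0, fun hk' => absurd hk' hk⟩
  choose c hc using hpw
  have hmeas : ∀ k, Measurable (trunc k u) := fun k => (continuous_trunc_fun k).measurable.comp hu
  -- `trunc j (trunc k u) = trunc j u` for `j ≤ k`, so the gradients at different heights agree
  -- wherever the lower truncation is not active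
  have hgrad : ∀ᵐ t, ∀ k, 1 ≤ k → ∀ j ≤ k, g j t = if |u t| < j then g k t else 0 := by
    refine ae_all_iff.2 fun k => ?_
    by_cases hk : 1 ≤ k
    swap
    · exact Eventually.of_forall fun t hk' => absurd hk' hk
    have : ∀ᵐ t, ∀ j, j ≤ k → g j t = if |u t| < j then g k t else 0 := by
      refine ae_all_iff.2 fun j => ?_
      by_cases hj : j ≤ k
      swap
      · exact Eventually.of_forall fun t hj' => absurd hj' hj
      have e : trunc j (trunc k u) = trunc j u := funext fun t => clamp_clamp hj (u t)
      have := (hc k hk).rnDeriv_trunc (hmeas k) j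
      rw [e] at this
      filter_upwards [this] with t ht _
      refine Eq.trans ht ?_
      exact if_congr (abs_clamp_lt_iff hj (u t)) rfl rfl
    filter_upwards [this] with t ht _ using ht
  have hgle : ∀ k, 1 ≤ k → ∀ᵐ t, ‖g k t‖ₑ ≤ ‖approxGradient u t‖ₑ := by
    intro k hk
    filter_upwards [hgrad] with t ht
    by_cases hlt : |u t| < k
    · have hfl : ⌊|u t|⌋₊ + 1 ≤ k := by
        have := (Nat.floor_lt (abs_nonneg (u t))).2 hlt
        omega
      have := ht k hk _ hfl
      rw [if_pos (by push_cast; exact Nat.lt_floor_add_one _)] at this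
      rw [← this]
      exact le_rfl
    · have := ht k hk k le_rfl
      rw [if_neg hlt] at this
      simp [this]
  set L := (1 + ∫⁻ t, ‖approxGradient u t‖ₑ ^ 2).toReal with hL
  have hgL : ∀ k, 1 ≤ k → ∫ t, |g k t| ≤ L := by
    intro k hk
    have e1 := integral_norm_eq_lintegral_enorm (hc k hk).int.1
    simp only [Real.norm_eq_abs] at e1
    rw [e1]
    refine ENNReal.toReal_mono (ENNReal.add_ne_top.2 ⟨ENNReal.one_ne_top, hM⟩)
      ((lintegral_enorm_le_one_add _).trans ?_)
    gcongr 1 + ?_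
    refine lintegral_mono_ae ?_
    filter_upwards [hgle k hk] with t ht
    gcongr
  -- `u` is bounded on each piece: at a point `x₀` where the representations of all truncations
  -- hold, `u` is finite, and on the piece `u` differs from `u x₀` by at most `2 * L`
  have hbd : ∀ j ≤ F.card, ∃ B : ℝ, ∀ᵐ x : ℝ, x ∈ Ioo (τ j) (τ (j + 1)) → |u (x : Circ)| ≤ B := by
    intro j hj
    have hgen : ∀ᵐ x : ℝ, ∀ k, 1 ≤ k → x ∈ Ioo (τ j) (τ (j + 1)) →
        trunc k u (x : Circ) = c k j + prim (g k) x := by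
      refine ae_all_iff.2 fun k => ?_
      by_cases hk : 1 ≤ k
      · filter_upwards [(hc k hk).eq j hj] with x hx _ using hx
      · exact Eventually.of_forall fun x hk' => absurd hk' hk
    by_cases hex : ∃ x₀ ∈ Ioo (τ j) (τ (j + 1)), ∀ k, 1 ≤ k →
        trunc k u (x₀ : Circ) = c k j + prim (g k) x₀
    · obtain ⟨x₀, hx₀, hx₀c⟩ := hex
      refine ⟨|u (x₀ : Circ)| + 2 * L, ?_⟩
      filter_upwards [hgen] with x hx hxI
      obtain ⟨k, hk⟩ := exists_nat_ge (max 1 (max |u (x : Circ)| |u (x₀ : Circ)|))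
      have hk1 : 1 ≤ k := by exact_mod_cast (le_max_left _ _).trans hk
      have hP := hc k hk1
      have hmemI : ∀ y ∈ Ioo (τ j) (τ (j + 1)), y ∈ Icc (0 : ℝ) 1 := fun y hy =>
        ⟨((hP.mem_Icc (j := j) (by omega)).1.trans_lt hy.1).le,
          hy.2.le.trans (hP.mem_Icc (j := j + 1) (by omega)).2⟩
      have a1 : u (x : Circ) = c k j + prim (g k) x := by
        rw [← hx k hk1 hxI]
        exact (clamp_of_abs_le (((le_max_left _ _).trans (le_max_right _ _)).trans hk)).symm
      have a2 : u (x₀ : Circ) = c k j + prim (g k) x₀ := by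
        rw [← hx₀c k hk1]
        exact (clamp_of_abs_le (((le_max_right _ _).trans (le_max_right _ _)).trans hk)).symm
      have b1 := (abs_prim_le hP.int (hmemI x hxI)).trans (hgL k hk1)
      have b2 := (abs_prim_le hP.int (hmemI x₀ hx₀)).trans (hgL k hk1)
      have e : u (x : Circ) = u (x₀ : Circ) + (prim (g k) x - prim (g k) x₀) := by
        rw [a1, a2]; ring
      calc |u (x : Circ)| ≤ |u (x₀ : Circ)| + |prim (g k) x - prim (g k) x₀| := by
            rw [e]; exact abs_add_le _ _
        _ ≤ |u (x₀ : Circ)| + (|prim (g k) x| + |prim (g k) x₀|) := by gcongr; exact abs_sub _ _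
        _ ≤ _ := by linarith
    · refine ⟨0, ?_⟩
      filter_upwards [hgen] with x hx hxI
      exact absurd ⟨x, hxI, fun k hk => hx k hk hxI⟩ hex
  have hbound : ∃ K : ℕ, 1 ≤ K ∧ ∀ᵐ t, |u t| ≤ K := by
    choose! B hB using hbd
    obtain ⟨K, hK⟩ := exists_nat_ge (1 + ∑ j ∈ Finset.range (F.card + 1), |B j|)
    refine ⟨K, ?_, ?_⟩
    · have : (0 : ℝ) ≤ ∑ j ∈ Finset.range (F.card + 1), |B j| :=
        Finset.sum_nonneg fun _ _ => abs_nonneg _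
      exact_mod_cast (by linarith : (1 : ℝ) ≤ K)
    · rw [ae_circ_iff]
      refine (hc 1 le_rfl).ae_of_forall fun j hj => ?_
      filter_upwards [hB j hj] with x hx hxI
      have := Finset.single_le_sum (f := fun j => |B j|) (fun i _ => abs_nonneg _)
        (Finset.mem_range.2 (Nat.lt_succ_of_le hj))
      have h2 := (hx hxI).trans (le_abs_self _)
      linarith
  obtain ⟨K, hK1, hK⟩ := hbound
  -- `u` agrees with its truncation at height `K`, so that its jump set may serve as set of nodes
  have hae := IsPiecewise.trunc_ae_eq hK
  have hjump : jumpSet (trunc K u) ⊆ (hS.toFinset : Set Circ) := by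
    rw [jumpSet_congr_ae hae, Finite.coe_toFinset]
  obtain ⟨τ', hmono', h0', h1', hτF'⟩ := exists_partition hS.toFinset
  obtain ⟨c', hc'⟩ := (hT K).exists_isPiecewise hjump hmono' h0' h1' hτF'
  have hfin := hc'.congr_ae hae
  refine ⟨_, τ', c', _, hfin, h1', SignedMeasure.measurable_rnDeriv _ _, ?_⟩
  rw [hMS]
  congr 1
  · refine lintegral_congr_ae ?_
    filter_upwards [hfin.approxGradient_ae_eq hu] with t ht
    rw [ht]
  · rw [hS.encard_eq_coe_toFinset_card]
    simp

/-! ### Integrals over arcs of functions in negative Sobolev spaces -/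

lemma setIntegral_rep_Ioc {E : Type*} [NormedAddCommGroup E] [NormedSpace ℝ E] (f : Circ → E)
    {a b : ℝ} (ha : 0 ≤ a) (hab : a ≤ b) (hb : b ≤ 1) :
    ∫ t in rep ⁻¹' Ioc a b, f t = ∫ x in a..b, f (x : Circ) := by
  have hm : MeasurableSet (rep ⁻¹' Ioc a b) := measurable_rep measurableSet_Ioc
  have key := UnitAddCircle.intervalIntegral_preimage 0 ((rep ⁻¹' Ioc a b).indicator f)
  rw [← integral_indicator hm, ← key, zero_add, intervalIntegral.integral_of_le zero_le_one,
    intervalIntegral.integral_of_le hab]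
  have h2 : Ioc a b = Ioc a b ∩ Ioc (0 : ℝ) 1 :=
    (inter_eq_left.2 (Ioc_subset_Ioc ha hb)).symm
  rw [h2, ← Measure.restrict_restrict measurableSet_Ioc,
    ← integral_indicator (f := fun x : ℝ => f (x : Circ)) measurableSet_Ioc]
  refine integral_congr_ae ?_
  filter_upwards [ae_restrict_mem measurableSet_Ioc] with y hy
  rw [← h2]
  simp only [indicator, mem_preimage, rep_coe hy]

lemma volume_eq_haarAddCircle :
    (volume : Measure Circ) = AddCircle.haarAddCircle (T := (1 : ℝ)) := by
  rw [AddCircle.volume_eq_smul_haarAddCircle]; simp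

/-- A bound for the Fourier coefficients of indicator functions of arcs that is uniform in the
length of the arc. The value at `k = 0` is given separately, since `1 / 0 = 0`. -/
def arcBound (k : ℤ) : ℝ := if k = 0 then 1 else 1 / (Real.pi * |(k : ℝ)|)

lemma arcBound_nonneg (k : ℤ) : 0 ≤ arcBound k := by
  unfold arcBound; split_ifs <;> positivity

lemma norm_integral_fourier_le (k : ℤ) {a b : ℝ} (hab : a ≤ b) (hb : b - a ≤ 1) :
    ‖∫ x in a..b, fourier (T := (1 : ℝ)) k (x : Circ)‖ ≤ min |b - a| (arcBound k) := by
  have h1 : ‖∫ x in a..b, fourier (T := (1 : ℝ)) k (x : Circ)‖ ≤ |b - a| := by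
    refine (intervalIntegral.norm_integral_le_of_norm_le_const (C := 1) fun x _ => ?_).trans_eq
      (one_mul _)
    rw [fourier_apply]; exact (Circle.norm_coe _).le
  refine le_min h1 ?_
  by_cases hk : k = 0
  · rw [arcBound, if_pos hk]
    refine h1.trans ?_
    rwa [abs_of_nonneg (by linarith)]
  · rw [arcBound, if_neg hk]
    have hk' : (k : ℂ) ≠ 0 := by exact_mod_cast hk
    have hkr : (k : ℝ) ≠ 0 := by exact_mod_cast hk
    set c : ℂ := 2 * Real.pi * Complex.I * k with hc
    have hc0 : c ≠ 0 := by
      simp [hc, hk', Real.pi_ne_zero]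
    have e : ∀ x : ℝ, fourier (T := (1 : ℝ)) k (x : Circ) = Complex.exp (c * x) := by
      intro x
      rw [fourier_coe_apply, hc]
      simp
    have hn : ∀ x : ℝ, ‖Complex.exp (c * x)‖ = 1 := by
      intro x
      rw [← e, fourier_apply]; exact Circle.norm_coe _
    simp_rw [e]
    rw [integral_exp_mul_complex hc0, norm_div]
    have hcn : ‖c‖ = 2 * (Real.pi * |(k : ℝ)|) := by
      simp [hc, abs_of_pos Real.pi_pos]; ring
    have h2 : ‖Complex.exp (c * b) - Complex.exp (c * a)‖ ≤ 2 :=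
      (norm_sub_le _ _).trans (by rw [hn, hn]; norm_num)
    have hpos : 0 < Real.pi * |(k : ℝ)| := by positivity
    rw [hcn, div_le_div_iff₀ (by positivity) hpos]
    nlinarith

/-- The terms of the square of a bound for the norm in `H^s(𝕋)` of the indicator function of an
arc of length `ε`. -/
def modulusTerm (s ε : ℝ) (k : ℤ) : ℝ :=
  (1 + (2 * Real.pi * k) ^ 2) ^ s * min |ε| (arcBound k) ^ 2

lemma modulusTerm_nonneg (s ε : ℝ) (k : ℤ) : 0 ≤ modulusTerm s ε k := by
  unfold modulusTerm; positivity

/-- The indicator function of an arc belongs to `H^s(𝕋)` for `s < 1 / 2`, uniformly in the arc. -/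
lemma exists_summable_modulusTerm_le {s : ℝ} (hs : s < 1 / 2) :
    ∃ B : ℤ → ℝ, Summable B ∧ ∀ ε k, modulusTerm s ε k ≤ B k := by
  set r := max s 0 with hr
  have hr0 : 0 ≤ r := le_max_right _ _
  have hr2 : r < 1 / 2 := max_lt hs (by norm_num)
  have hsum := (Real.summable_abs_int_rpow (b := 2 - 2 * r) (by linarith)).mul_left (41 ^ r : ℝ)
  refine ⟨fun k => (41 ^ r : ℝ) * |(k : ℝ)| ^ (-(2 - 2 * r)) + if k = 0 then 1 else 0,
    hsum.add ?_, ?_⟩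
  · exact (hasSum_ite_eq (0 : ℤ) (1 : ℝ)).summable
  · intro ε k
    by_cases hk : k = 0
    · have : min |ε| (arcBound k) ≤ 1 := by
        refine (min_le_right _ _).trans ?_
        rw [arcBound, if_pos hk]
      have h0 : 0 ≤ min |ε| (arcBound k) := le_min (abs_nonneg _) (arcBound_nonneg k)
      have h3 : min |ε| (arcBound k) ^ 2 ≤ 1 := by nlinarith
      have h4 : 0 ≤ (41 ^ r : ℝ) * |(k : ℝ)| ^ (-(2 - 2 * r)) := by positivity
      have h5 : modulusTerm s ε k = min |ε| (arcBound k) ^ 2 := by simp [modulusTerm, hk]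
      simp only [h5, if_pos hk]
      linarith
    · simp only [if_neg hk, add_zero]
      have hk1 : (1 : ℝ) ≤ |(k : ℝ)| := by exact_mod_cast Int.one_le_abs hk
      have hk0 : (0 : ℝ) < |(k : ℝ)| := by linarith
      have h1 : (1 + (2 * Real.pi * k) ^ 2) ^ s ≤ 41 ^ r * |(k : ℝ)| ^ (2 * r) := by
        calc (1 + (2 * Real.pi * k) ^ 2) ^ s ≤ (1 + (2 * Real.pi * k) ^ 2) ^ r :=
              Real.rpow_le_rpow_of_exponent_le (by nlinarith [sq_nonneg (2 * Real.pi * k)])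
                (le_max_left _ _)
          -- `1 ≤ k ^ 2` and `4 * π ^ 2 ≤ 40`
          _ ≤ (41 * |(k : ℝ)| ^ 2) ^ r := by
              refine Real.rpow_le_rpow (by positivity) ?_ hr0
              have hpi : Real.pi ^ 2 ≤ 10 := by
                nlinarith [Real.pi_lt_d2, Real.pi_pos]
              have : (1 : ℝ) ≤ k ^ 2 := by rw [← sq_abs]; nlinarith
              rw [sq_abs]
              nlinarith
          _ = _ := by
              rw [Real.mul_rpow (by norm_num) (by positivity), Real.rpow_mul hk0.le,
                Real.rpow_two]
      have h2 : min |ε| (arcBound k) ^ 2 ≤ |(k : ℝ)| ^ (-2 : ℝ) := by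
        have h0 : 0 ≤ min |ε| (arcBound k) := le_min (abs_nonneg _) (arcBound_nonneg k)
        have h3 : min |ε| (arcBound k) ≤ |(k : ℝ)|⁻¹ := by
          refine (min_le_right _ _).trans ?_
          rw [arcBound, if_neg hk, one_div]
          refine inv_anti₀ hk0 ?_
          nlinarith [Real.pi_gt_three]
        rw [Real.rpow_neg hk0.le, Real.rpow_two, ← inv_pow]
        gcongr
      calc modulusTerm s ε k ≤ (41 ^ r * |(k : ℝ)| ^ (2 * r)) * |(k : ℝ)| ^ (-2 : ℝ) := by
            unfold modulusTerm; gcongr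
        _ = _ := by
            rw [mul_assoc, ← Real.rpow_add hk0]
            congr 2; ring

/-- An upper bound for the norm in `H^s(𝕋)` of the indicator function of an arc of length
`ε ≤ 1`. -/
def modulus (s ε : ℝ) : ℝ := √(∑' k, modulusTerm s ε k)

lemma modulus_nonneg (s ε : ℝ) : 0 ≤ modulus s ε := Real.sqrt_nonneg _

lemma tendsto_modulus {s : ℝ} (hs : s < 1 / 2) : Tendsto (modulus s) (𝓝 0) (𝓝 0) := by
  obtain ⟨B, hB, hle⟩ := exists_summable_modulusTerm_le hs
  have h := tendsto_tsum_of_dominated_convergence (𝓕 := 𝓝 (0 : ℝ)) (f := modulusTerm s)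
    (g := fun _ => 0) hB (fun k => ?_) (Eventually.of_forall fun ε k => ?_)
  · rw [tsum_zero] at h
    have := (Real.continuous_sqrt.tendsto 0).comp h
    rwa [Real.sqrt_zero] at this
  · have hc : Continuous fun ε => modulusTerm s ε k := by unfold modulusTerm; fun_prop
    have := hc.tendsto 0
    simpa [modulusTerm, min_eq_left (arcBound_nonneg k)] using this
  · rw [Real.norm_of_nonneg (modulusTerm_nonneg _ _ _)]
    exact hle ε k

lemma exists_modulus_le {s : ℝ} (hs : s < 1 / 2) : ∃ W, ∀ ε, modulus s ε ≤ W := by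
  obtain ⟨B, hB, hle⟩ := exists_summable_modulusTerm_le hs
  refine ⟨√(∑' k, B k), fun ε => Real.sqrt_le_sqrt ?_⟩
  exact (Summable.of_nonneg_of_le (modulusTerm_nonneg s ε) (hle ε) hB).tsum_le_tsum (hle ε) hB

/-- The Cauchy–Schwarz inequality for series. -/
lemma tsum_mul_le_sqrt {ι : Type*} (f g : ι → ℝ≥0∞) :
    ∑' i, f i * g i ≤ (∑' i, f i ^ 2) ^ (1 / 2 : ℝ) * (∑' i, g i ^ 2) ^ (1 / 2 : ℝ) := by
  let _ : MeasurableSpace ι := ⊤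
  have := ENNReal.lintegral_mul_le_Lp_mul_Lq (Measure.count : Measure ι)
    Real.HolderConjugate.two_two (f := f) (g := g) (by fun_prop) (by fun_prop)
  simpa [lintegral_count] using this

/-- The duality between `H^{-s}(𝕋)` and `H^s(𝕋)`, applied to the indicator function of an arc. -/
theorem abs_integral_le_modulus {s : ℝ} (hs : s < 1 / 2) {f : Circ → ℝ}
    (hfm : MemLp f 2 volume) {M : ℝ} (hM : 0 ≤ M)
    (hf : sobolevNorm (-s) f ≤ ENNReal.ofReal M) {a b : ℝ} (ha : 0 ≤ a) (hab : a ≤ b)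
    (hb : b ≤ 1) : |∫ x in a..b, f (x : Circ)| ≤ M * modulus s (b - a) := by
  have hm : MeasurableSet (rep ⁻¹' Ioc a b) := measurable_rep measurableSet_Ioc
  have hF : MemLp (fun t => (f t : ℂ)) 2 (AddCircle.haarAddCircle (T := (1 : ℝ))) := by
    rw [← volume_eq_haarAddCircle]; exact hfm.ofReal
  have hFae := hF.coeFn_toLp
  set F := hF.toLp with hFdef
  set G := indicatorConstLp 2 hm (measure_ne_top (AddCircle.haarAddCircle (T := (1 : ℝ))) _) (1 : ℂ)
  have hGF : inner ℂ G F = ((∫ x in a..b, f (x : Circ) : ℝ) : ℂ) := by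
    rw [L2.inner_indicatorConstLp_one, ← intervalIntegral.integral_ofReal,
      ← setIntegral_rep_Ioc (fun t => (f t : ℂ)) ha hab hb, volume_eq_haarAddCircle]
    exact integral_congr_ae (ae_restrict_of_ae hFae)
  have hGb : ∀ k, inner ℂ G (fourierBasis (T := (1 : ℝ)) k) =
      ∫ x in a..b, fourier (T := (1 : ℝ)) k (x : Circ) := by
    intro k
    rw [L2.inner_indicatorConstLp_one,
      ← setIntegral_rep_Ioc (fun t => fourier (T := (1 : ℝ)) k t) ha hab hb,
      volume_eq_haarAddCircle, coe_fourierBasis]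
    exact integral_congr_ae (ae_restrict_of_ae (coeFn_fourierLp 2 k))
  have hbF : ∀ k, inner ℂ (fourierBasis (T := (1 : ℝ)) k) F =
      fourierCoeff (T := (1 : ℝ)) (fun t => (f t : ℂ)) k := by
    intro k
    rw [← HilbertBasis.repr_apply_apply, fourierBasis_repr]
    refine integral_congr_ae ?_
    filter_upwards [hFae] with t ht
    rw [ht]
  have hsum := (fourierBasis (T := (1 : ℝ))).hasSum_inner_mul_inner G F
  have hw : ∀ k : ℤ, (0 : ℝ) < 1 + (2 * Real.pi * k) ^ 2 := fun k => by positivity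
  have key : ENNReal.ofReal |∫ x in a..b, f (x : Circ)| ≤
      ENNReal.ofReal (modulus s (b - a)) * ENNReal.ofReal M := by
    calc ENNReal.ofReal |∫ x in a..b, f (x : Circ)| = ‖inner ℂ G F‖ₑ := by
          rw [hGF, ← ofReal_norm, Complex.norm_real, Real.norm_eq_abs]
      _ ≤ ∑' k, ‖inner ℂ G (fourierBasis (T := (1 : ℝ)) k) *
            inner ℂ (fourierBasis (T := (1 : ℝ)) k) F‖ₑ := by
          rw [← hsum.tsum_eq]; exact enorm_tsum_le_tsum_enorm
      _ ≤ ∑' k : ℤ, ENNReal.ofReal ((1 + (2 * Real.pi * k) ^ 2) ^ (s / 2) *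
            min |b - a| (arcBound k)) * (ENNReal.ofReal ((1 + (2 * Real.pi * k) ^ 2) ^ (-s / 2)) *
            ‖fourierCoeff (T := (1 : ℝ)) (fun t => (f t : ℂ)) k‖ₑ) := by
          refine ENNReal.tsum_le_tsum fun k => ?_
          rw [enorm_mul, hGb, hbF, ← mul_assoc, ← ENNReal.ofReal_mul
            (mul_nonneg (Real.rpow_nonneg (hw k).le _)
              (le_min (abs_nonneg _) (arcBound_nonneg k)))]
          gcongr
          rw [← ofReal_norm]
          refine ENNReal.ofReal_le_ofReal ((norm_integral_fourier_le k hab (by linarith)).trans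
            (le_of_eq ?_))
          rw [mul_right_comm, ← Real.rpow_add (hw k), neg_div, add_neg_cancel, Real.rpow_zero,
            one_mul]
      _ ≤ _ := tsum_mul_le_sqrt _ _
      _ ≤ ENNReal.ofReal (modulus s (b - a)) * ENNReal.ofReal M := by
          gcongr
          · rw [modulus, Real.sqrt_eq_rpow, ← ENNReal.ofReal_rpow_of_nonneg
              (tsum_nonneg (modulusTerm_nonneg _ _)) (by norm_num)]
            gcongr
            obtain ⟨B, hB, hle⟩ := exists_summable_modulusTerm_le hs
            rw [ENNReal.ofReal_tsum_of_nonneg (modulusTerm_nonneg _ _)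
              (Summable.of_nonneg_of_le (modulusTerm_nonneg s _) (hle _) hB)]
            refine ENNReal.tsum_le_tsum fun k => le_of_eq ?_
            rw [← ENNReal.ofReal_pow (mul_nonneg (Real.rpow_nonneg (hw k).le _)
              (le_min (abs_nonneg _) (arcBound_nonneg k))), mul_pow, modulusTerm,
              ← Real.rpow_natCast, ← Real.rpow_mul (hw k).le]
            norm_num
          · refine le_trans (le_of_eq ?_) hf
            rw [sobolevNorm]
            congr 2
            funext k
            rw [mul_pow, ← ENNReal.ofReal_pow (Real.rpow_nonneg (hw k).le _),
              ← Real.rpow_natCast, ← Real.rpow_mul (hw k).le]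
            norm_num
  rw [← ENNReal.ofReal_mul (modulus_nonneg _ _),
    ENNReal.ofReal_le_ofReal_iff (mul_nonneg (modulus_nonneg _ _) hM)] at key
  rwa [mul_comm] at key

/-! ### Weak compactness of the gradients -/

/-- Bounded sequences in a separable Hilbert space have weakly convergent subsequences, by the
Banach–Alaoglu theorem. -/
lemma exists_subseq_tendsto_inner {H : Type*} [NormedAddCommGroup H] [InnerProductSpace ℝ H]
    [CompleteSpace H] [TopologicalSpace.SeparableSpace H] {x : ℕ → H} {K : ℝ}
    (hx : ∀ n, ‖x n‖ ≤ K) : ∃ (y : H) (φ : ℕ → ℕ), StrictMono φ ∧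
      ∀ h, Tendsto (fun n => inner ℝ (x (φ n)) h) atTop (𝓝 (inner ℝ y h)) := by
  obtain ⟨a, -, φ, hφ, ha⟩ := WeakDual.isSeqCompact_closedBall ℝ H 0 K
    (x := fun n => StrongDual.toWeakDual (InnerProductSpace.toDual ℝ H (x n)))
    (fun n => by simpa using hx n)
  refine ⟨(InnerProductSpace.toDual ℝ H).symm (WeakDual.toStrongDual a), φ, hφ, fun h => ?_⟩
  have := (WeakDual.eval_continuous h).continuousAt.tendsto.comp ha
  rw [InnerProductSpace.toDual_symm_apply]
  exact this

/-- The norm is weakly lower semicontinuous. -/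
lemma norm_le_of_tendsto_inner {H : Type*} [NormedAddCommGroup H] [InnerProductSpace ℝ H]
    {x : ℕ → H} {y : H} {r : ℝ} (h : Tendsto (fun n => inner ℝ (x n) y) atTop (𝓝 (inner ℝ y y)))
    (hr : Tendsto (fun n => ‖x n‖) atTop (𝓝 r)) : ‖y‖ ≤ r := by
  have h1 : inner ℝ y y ≤ r * ‖y‖ :=
    le_of_tendsto_of_tendsto' h (hr.mul_const _) fun n => real_inner_le_norm _ _
  rw [real_inner_self_eq_norm_mul_norm] at h1
  rcases (norm_nonneg y).eq_or_lt with h0 | h0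
  · rw [← h0]; exact ge_of_tendsto' hr fun n => norm_nonneg _
  · exact le_of_mul_le_mul_right h1 h0

/-- Evaluations of primitives are weakly continuous functionals on `L²(𝕋)`. -/
lemma inner_arc_eq_prim (G : LpCirc 2) {x : ℝ} (hx : x ∈ Icc (0 : ℝ) 1) :
    inner ℝ G (indicatorConstLp 2 (measurableSet_rep_le x) (measure_ne_top volume _) (1 : ℝ)) =
      prim G x := by
  rw [real_inner_comm, L2.inner_indicatorConstLp_one, setIntegral_rep_le hx, prim]

/-! ### Convergence of piecewise absolutely continuous functions -/

lemma continuous_prim {g : Circ → ℝ} (hg : Integrable g) : Continuous (prim g) := by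
  refine intervalIntegral.continuous_primitive (fun a b => ?_) 0
  have hp : Function.Periodic (fun y : ℝ => g (y : Circ)) 1 := fun y => by simp
  refine hp.intervalIntegrable₀ one_ne_zero ?_ a b
  exact intervalIntegrable_coe hg

/-- The step function on the unit interval with nodes `τ` and values `c`. -/
def stepFun (p : ℕ) (τ c : ℕ → ℝ) (x : ℝ) : ℝ :=
  ∑ j ∈ Finset.range (p + 1), (Ioo (τ j) (τ (j + 1))).indicator (fun _ => c j) x

lemma stepFun_of_mem {p : ℕ} {τ : ℕ → ℝ} (hτ : Monotone τ) (c : ℕ → ℝ) {j : ℕ} (hj : j ≤ p)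
    {x : ℝ} (hx : x ∈ Ioo (τ j) (τ (j + 1))) : stepFun p τ c x = c j := by
  rw [stepFun, Finset.sum_eq_single_of_mem j (Finset.mem_range.2 (by omega)), indicator_of_mem hx]
  intro i _ hij
  refine indicator_of_notMem (fun hxi => ?_) _
  rcases lt_or_gt_of_ne hij with h | h
  · have := hτ (show i + 1 ≤ j by omega)
    linarith [hxi.2, hx.1]
  · have := hτ (show j + 1 ≤ i by omega)
    linarith [hxi.1, hx.2]

lemma measurable_stepFun (p : ℕ) (τ c : ℕ → ℝ) : Measurable (stepFun p τ c) := by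
  unfold stepFun
  exact Finset.measurable_fun_sum _ fun j _ => measurable_const.indicator measurableSet_Ioo

lemma abs_stepFun_le (p : ℕ) (τ c : ℕ → ℝ) (x : ℝ) :
    |stepFun p τ c x| ≤ ∑ j ∈ Finset.range (p + 1), |c j| := by
  refine (Finset.abs_sum_le_sum_abs _ _).trans (Finset.sum_le_sum fun j _ => ?_)
  simpa using norm_indicator_le_norm_self (fun _ => c j) x

lemma stepFun_sub (p : ℕ) (τ c d : ℕ → ℝ) (x : ℝ) :
    stepFun p τ (fun j => c j - d j) x = stepFun p τ c x - stepFun p τ d x := by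
  simp only [stepFun, ← Finset.sum_sub_distrib]
  refine Finset.sum_congr rfl fun j _ => ?_
  exact congrFun (indicator_sub' (Ioo (τ j) (τ (j + 1))) (fun _ => c j) (fun _ => d j)) x

lemma lintegral_stepFun_le (p : ℕ) {τ : ℕ → ℝ} (hτ : Monotone τ) (c : ℕ → ℝ) :
    ∫⁻ t, ‖stepFun p τ c (rep t)‖ₑ ≤
      ENNReal.ofReal (∑ j ∈ Finset.range (p + 1), |c j| * (τ (j + 1) - τ j)) := by
  have hm : ∀ j, MeasurableSet (rep ⁻¹' Ioo (τ j) (τ (j + 1))) := fun j =>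
    measurable_rep measurableSet_Ioo
  calc ∫⁻ t, ‖stepFun p τ c (rep t)‖ₑ
      ≤ ∫⁻ t, ∑ j ∈ Finset.range (p + 1),
          (rep ⁻¹' Ioo (τ j) (τ (j + 1))).indicator (fun _ => ‖c j‖ₑ) t := by
        refine lintegral_mono fun t => ?_
        refine (enorm_sum_le _ _).trans (Finset.sum_le_sum fun j _ => le_of_eq ?_)
        rw [enorm_indicator_eq_indicator_enorm]
        rfl
    _ = ∑ j ∈ Finset.range (p + 1), ‖c j‖ₑ * volume (rep ⁻¹' Ioo (τ j) (τ (j + 1))) := by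
        rw [lintegral_finsetSum _ fun j _ => measurable_const.indicator (hm j)]
        refine Finset.sum_congr rfl fun j _ => ?_
        rw [lintegral_indicator (hm j), setLIntegral_const]
    _ ≤ ∑ j ∈ Finset.range (p + 1), ENNReal.ofReal (|c j| * (τ (j + 1) - τ j)) := by
        refine Finset.sum_le_sum fun j _ => ?_
        rw [ENNReal.ofReal_mul (abs_nonneg _), ← ofReal_norm, Real.norm_eq_abs]
        gcongr
        rw [measurePreserving_rep.measure_preimage measurableSet_Ioo.nullMeasurableSet]
        refine (Measure.restrict_apply_le _ _).trans_eq ?_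
        rw [Real.volume_Ioo]
    _ = _ := by
        rw [ENNReal.ofReal_sum_of_nonneg]
        exact fun j _ => mul_nonneg (abs_nonneg _) (sub_nonneg.2 (hτ (Nat.le_succ j)))

/-- The values on collapsing pieces do not matter for convergence away from the nodes. -/
lemma tendsto_stepFun {p : ℕ} {τ c : ℕ → ℕ → ℝ} {τ' c' : ℕ → ℝ}
    (hτ : ∀ j, Tendsto (fun n => τ n j) atTop (𝓝 (τ' j)))
    (hc : ∀ j ≤ p, τ' j < τ' (j + 1) → Tendsto (fun n => c n j) atTop (𝓝 (c' j))) {x : ℝ}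
    (hx : ∀ j, x ≠ τ' j) :
    Tendsto (fun n => stepFun p (τ n) (c n) x) atTop (𝓝 (stepFun p τ' c' x)) := by
  refine tendsto_finsetSum _ fun j hj => ?_
  have hj' : j ≤ p := by have := Finset.mem_range.1 hj; omega
  by_cases hxI : x ∈ Ioo (τ' j) (τ' (j + 1))
  · rw [indicator_of_mem hxI]
    refine (hc j hj' (hxI.1.trans hxI.2)).congr' ?_
    filter_upwards [(hτ j).eventually_lt_const hxI.1, (hτ (j + 1)).eventually_const_lt hxI.2]
      with n h1 h2
    rw [indicator_of_mem (show x ∈ Ioo (τ n j) (τ n (j + 1)) from ⟨h1, h2⟩)]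
  · rw [indicator_of_notMem hxI]
    refine tendsto_const_nhds.congr' ?_
    have : x < τ' j ∨ τ' (j + 1) < x := by
      rcases lt_or_gt_of_ne (hx j) with h | h
      · exact Or.inl h
      · refine Or.inr (lt_of_le_of_ne ?_ (hx (j + 1)).symm)
        by_contra hlt
        exact hxI ⟨h, not_le.1 hlt⟩
    rcases this with h | h
    · filter_upwards [(hτ j).eventually_const_lt h] with n hn
      exact (indicator_of_notMem (fun hxn => (hn.trans hxn.1).false) _).symm
    · filter_upwards [(hτ (j + 1)).eventually_lt_const h] with n hn
      exact (indicator_of_notMem (fun hxn => (hn.trans hxn.2).false) _).symm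

lemma IsPiecewise.ae_eq_stepFun {p : ℕ} {τ c : ℕ → ℝ} {g u : Circ → ℝ}
    (h : IsPiecewise p τ c g u) :
    ∀ᵐ t, u t = stepFun p τ c (rep t) + prim g (rep t) := by
  rw [ae_circ_iff]
  have h1 := h.ae_of_forall (P := fun x => u (x : Circ) = stepFun p τ c x + prim g x)
    fun j hj => ?_
  · filter_upwards [h1, ae_restrict_mem measurableSet_Ioc] with x hx hxI
    rw [rep_coe hxI, hx]
  · filter_upwards [h.eq j hj] with x hx hxI
    rw [hx hxI, stepFun_of_mem h.mono c hj hxI]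

/-- Piecewise absolutely continuous functions converge in `L¹` if their nodes converge, their
values on the pieces that do not collapse converge, the primitives of their gradients converge,
and the mass on collapsing pieces tends to zero. -/
theorem IsPiecewise.exists_of_tendsto {p : ℕ} {τ c : ℕ → ℕ → ℝ} {g u : ℕ → Circ → ℝ}
    {τ' c' : ℕ → ℝ} {g' : Circ → ℝ} {L : ℝ}
    (h : ∀ n, IsPiecewise p (τ n) (c n) (g n) (u n))
    (hτ : ∀ j, Tendsto (fun n => τ n j) atTop (𝓝 (τ' j)))
    (hg' : Integrable g') (hL : ∀ n, ∫ t, |g n t| ≤ L)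
    (hg : ∀ x ∈ Icc (0 : ℝ) 1, Tendsto (fun n => prim (g n) x) atTop (𝓝 (prim g' x)))
    (hc : ∀ j ≤ p, τ' j < τ' (j + 1) → Tendsto (fun n => c n j) atTop (𝓝 (c' j)))
    (hcol : ∀ j ≤ p, τ' j = τ' (j + 1) →
      Tendsto (fun n => |c n j| * (τ n (j + 1) - τ n j)) atTop (𝓝 0)) :
    ∃ v : Circ → ℝ, IsPiecewise p τ' c' g' v ∧ Measurable v ∧
      Tendsto (fun n => ∫⁻ t, ‖u n t - v t‖ₑ) atTop (𝓝 0) := by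
  classical
  have hmono : Monotone τ' := fun i j hij => le_of_tendsto_of_tendsto' (hτ i) (hτ j)
    fun n => (h n).mono hij
  have hz : τ' 0 = 0 := tendsto_nhds_unique (hτ 0)
    (tendsto_const_nhds.congr fun n => (h n).zero.symm)
  have hl : τ' (p + 1) = 1 := tendsto_nhds_unique (hτ (p + 1))
    (tendsto_const_nhds.congr fun n => (h n).last.symm)
  have h01 : ∀ j ≤ p + 1, τ' j ∈ Icc (0 : ℝ) 1 := fun j hj =>
    ⟨hz ▸ hmono (Nat.zero_le j), hl ▸ hmono hj⟩
  set v : Circ → ℝ := fun t => stepFun p τ' c' (rep t) + prim g' (rep t) with hv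
  have hvm : Measurable v := ((measurable_stepFun _ _ _).comp measurable_rep).add
    ((continuous_prim hg').measurable.comp measurable_rep)
  refine ⟨v, ⟨hmono, hz, hl, hg', ?_, ?_⟩, hvm, ?_⟩
  · intro j hj
    refine Eventually.of_forall fun x hx => ?_
    have hx01 : x ∈ Ioc (0 : ℝ) 1 :=
      ⟨(h01 j (by omega)).1.trans_lt hx.1, hx.2.le.trans (h01 (j + 1) (by omega)).2⟩
    simp only [hv]
    rw [rep_coe hx01, stepFun_of_mem hmono c' hj hx]
  · intro hne
    -- no node lies at the origin, so that the first and the last piece do not collapse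
    have hev : ∀ᶠ n in atTop, ∀ j ∈ Finset.Icc 1 p, ((τ n j : ℝ) : Circ) ≠ 0 := by
      rw [Filter.eventually_all_finset]
      intro j hj
      have hj' := Finset.mem_Icc.1 hj
      have hcont : Tendsto (fun n => ((τ n j : ℝ) : Circ)) atTop (𝓝 ((τ' j : ℝ) : Circ)) :=
        ((AddCircle.continuous_mk' (1 : ℝ)).tendsto _).comp (hτ j)
      exact hcont.eventually_ne (hne j hj'.1 hj'.2)
    have h1 : τ' 0 < τ' (0 + 1) := by
      rw [hz]
      rcases Nat.eq_zero_or_pos p with hp | hp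
      · subst hp; rw [hl]; exact one_pos
      · refine lt_of_le_of_ne (h01 _ (by omega)).1 fun heq => hne 1 le_rfl hp ?_
        rw [show τ' 1 = 0 from heq.symm]; simp
    have h2 : τ' p < τ' (p + 1) := by
      rw [hl]
      rcases Nat.eq_zero_or_pos p with hp | hp
      · subst hp; rw [hz]; exact one_pos
      · refine lt_of_le_of_ne (h01 _ (by omega)).2 fun heq => hne p hp le_rfl ?_
        rw [heq]; simp
    refine tendsto_nhds_unique ((hc p le_rfl h2).add (hg 1 (by simp)))
      ((hc 0 (Nat.zero_le p) h1).congr' ?_)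
    filter_upwards [hev] with n hn
    exact ((h n).glue fun j hj1 hj2 => hn j (Finset.mem_Icc.2 ⟨hj1, hj2⟩)).symm
  · -- the values on collapsing pieces, which may be unbounded, are removed first
    set d : ℕ → ℕ → ℝ := fun n j => if τ' j < τ' (j + 1) then c n j else 0 with hd
    have hbd : ∀ j, ∃ B, j ≤ p → ∀ n, |d n j| ≤ B := by
      intro j
      by_cases hj : j ≤ p
      · by_cases hlt : τ' j < τ' (j + 1)
        · obtain ⟨B, hB⟩ := (Metric.isBounded_range_of_tendsto _ (hc j hj hlt)).exists_norm_le
          refine ⟨B, fun _ n => ?_⟩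
          simp only [hd, if_pos hlt]
          exact hB _ (mem_range_self n)
        · exact ⟨0, fun _ n => by simp [hd, hlt]⟩
      · exact ⟨0, fun hj' => absurd hj' hj⟩
    choose B hB using hbd
    have hlim1 : Tendsto (fun n => ∫⁻ t, ENNReal.ofReal
        ‖(stepFun p (τ n) (d n) (rep t) + prim (g n) (rep t)) - v t‖) atTop (𝓝 0) := by
      refine tendsto_lintegral_norm_of_dominated_convergence
        (bound := fun _ => (∑ j ∈ Finset.range (p + 1), B j) + L) (fun n => ?_) ?_ (fun n => ?_) ?_
      · exact (((measurable_stepFun _ _ _).comp measurable_rep).add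
          ((continuous_prim (h n).int).measurable.comp measurable_rep)).aestronglyMeasurable
      · exact (integrable_const _).2
      · refine Eventually.of_forall fun t => (norm_add_le _ _).trans (add_le_add ?_ ?_)
        · refine (abs_stepFun_le _ _ _ _).trans (Finset.sum_le_sum fun j hj => ?_)
          exact hB j (by have := Finset.mem_range.1 hj; omega) n
        · exact (abs_prim_le (h n).int (Ioc_subset_Icc_self (rep_mem t))).trans (hL n)
      · have hnull : ∀ᵐ t : Circ, ∀ j, rep t ≠ τ' j := by
          refine ae_all_iff.2 fun j => ?_
          have hsub : {t : Circ | ¬ rep t ≠ τ' j}.Subsingleton := fun s hs t ht =>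
            rep_injective ((not_not.1 hs).trans (not_not.1 ht).symm)
          exact hsub.measure_zero volume
        filter_upwards [hnull] with t ht
        refine (tendsto_stepFun hτ (fun j hj hlt => ?_) ht).add
          (hg _ (Ioc_subset_Icc_self (rep_mem t)))
        simpa only [hd, if_pos hlt] using hc j hj hlt
    have hlim2 : Tendsto (fun n => ENNReal.ofReal
        (∑ j ∈ Finset.range (p + 1), |c n j - d n j| * (τ n (j + 1) - τ n j))) atTop (𝓝 0) := by
      rw [← ENNReal.ofReal_zero]
      refine ENNReal.tendsto_ofReal ?_
      rw [← Finset.sum_const_zero (s := Finset.range (p + 1))]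
      refine tendsto_finsetSum _ fun j hj => ?_
      have hj' : j ≤ p := by have := Finset.mem_range.1 hj; omega
      by_cases hlt : τ' j < τ' (j + 1)
      · simp [hd, hlt]
      · simpa [hd, hlt] using hcol j hj' (le_antisymm (hmono (Nat.le_succ j)) (not_lt.1 hlt))
    have hlim := hlim2.add hlim1
    rw [add_zero] at hlim
    refine tendsto_of_tendsto_of_tendsto_of_le_of_le tendsto_const_nhds hlim
      (fun _ => zero_le) fun n => ?_
    calc ∫⁻ t, ‖u n t - v t‖ₑ ≤ ∫⁻ t, (‖stepFun p (τ n) (fun j => c n j - d n j) (rep t)‖ₑ +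
          ENNReal.ofReal
            ‖(stepFun p (τ n) (d n) (rep t) + prim (g n) (rep t)) - v t‖) := by
          refine lintegral_mono_ae ?_
          filter_upwards [(h n).ae_eq_stepFun] with t ht
          rw [ht, ofReal_norm]
          refine le_trans (le_of_eq ?_) (enorm_add_le _ _)
          rw [stepFun_sub]
          congr 1
          ring
      _ = (∫⁻ t, ‖stepFun p (τ n) (fun j => c n j - d n j) (rep t)‖ₑ) + _ :=
          lintegral_add_left ((measurable_stepFun _ _ _).comp measurable_rep).enorm _
      _ ≤ _ := by
          gcongr
          exact lintegral_stepFun_le p (h n).mono _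

/-! ### Compactness of sequences of bounded energy -/

lemma lintegral_sq_enorm (G : LpCirc 2) :
    ∫⁻ t, ‖G t‖ₑ ^ 2 = ENNReal.ofReal (‖G‖ ^ 2) := by
  have h := eLpNorm_nnreal_pow_eq_lintegral (f := G) (μ := volume) (p := 2) two_ne_zero
  rw [ENNReal.ofReal_pow (norm_nonneg _), ofReal_norm, Lp.enorm_def]
  norm_num at h
  exact h.symm

lemma memLp_two_of_lintegral {g : Circ → ℝ} (hg : AEStronglyMeasurable g volume)
    (h : ∫⁻ t, ‖g t‖ₑ ^ 2 ≠ ⊤) : MemLp g 2 volume := by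
  refine ⟨hg, ?_⟩
  have h2 := eLpNorm_nnreal_pow_eq_lintegral (f := g) (μ := volume) (p := 2) two_ne_zero
  norm_num at h2
  rw [← h2] at h
  rw [lt_top_iff_ne_top]
  intro hh
  exact h (by rw [hh]; simp)

/-- The value of a piecewise absolutely continuous function on a piece is controlled by its
integral over this piece. -/
lemma IsPiecewise.abs_mul_le {p : ℕ} {τ c : ℕ → ℝ} {g u : Circ → ℝ} {L r : ℝ}
    (h : IsPiecewise p τ c g u) (hL : ∫ t, |g t| ≤ L) {j : ℕ} (hj : j ≤ p)
    (hr : |∫ x in τ j..τ (j + 1), u (x : Circ)| ≤ r) :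
    |c j| * (τ (j + 1) - τ j) ≤ r + L * (τ (j + 1) - τ j) := by
  have hle : τ j ≤ τ (j + 1) := h.mono (Nat.le_succ j)
  have h0 := h.mem_Icc (j := j) (by omega)
  have h1 := h.mem_Icc (j := j + 1) (by omega)
  have hint : IntervalIntegrable (prim g) volume (τ j) (τ (j + 1)) :=
    (continuous_prim h.int).intervalIntegrable _ _
  have e : ∫ x in τ j..τ (j + 1), u (x : Circ) =
      c j * (τ (j + 1) - τ j) + ∫ x in τ j..τ (j + 1), prim g x := by
    calc ∫ x in τ j..τ (j + 1), u (x : Circ) = ∫ x in τ j..τ (j + 1), (c j + prim g x) := by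
          rw [intervalIntegral.integral_of_le hle, intervalIntegral.integral_of_le hle,
            integral_Ioc_eq_integral_Ioo, integral_Ioc_eq_integral_Ioo]
          exact setIntegral_congr_ae measurableSet_Ioo (h.eq j hj)
      _ = _ := by
          rw [intervalIntegral.integral_add (by simp) hint]
          simp [mul_comm]
  have h2 : |∫ x in τ j..τ (j + 1), prim g x| ≤ L * (τ (j + 1) - τ j) := by
    have := intervalIntegral.norm_integral_le_of_norm_le_const (f := prim g) (C := L)
      (a := τ j) (b := τ (j + 1)) fun x hx => ?_
    · rwa [abs_of_nonneg (sub_nonneg.2 hle)] at this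
    · rw [uIoc_of_le hle] at hx
      exact (abs_prim_le h.int ⟨h0.1.trans hx.1.le, hx.2.trans h1.2⟩).trans hL
  calc |c j| * (τ (j + 1) - τ j) = |c j * (τ (j + 1) - τ j)| := by
        rw [abs_mul, abs_of_nonneg (sub_nonneg.2 hle)]
    _ = |(∫ x in τ j..τ (j + 1), u (x : Circ)) - ∫ x in τ j..τ (j + 1), prim g x| := by
        rw [e]; congr 1; ring
    _ ≤ _ := (abs_sub _ _).trans (add_le_add hr h2)

lemma IsPiecewise.integral_abs_le {p : ℕ} {τ c : ℕ → ℝ} {g u : Circ → ℝ} {Q : ℝ≥0∞}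
    (h : IsPiecewise p τ c g u) (hQ : Q ≠ ⊤) (hg : ∫⁻ t, ‖g t‖ₑ ^ 2 ≤ Q) :
    ∫ t, |g t| ≤ (1 + Q).toReal := by
  have e := integral_norm_eq_lintegral_enorm h.int.1
  simp only [Real.norm_eq_abs] at e
  rw [e]
  refine ENNReal.toReal_mono (ENNReal.add_ne_top.2 ⟨ENNReal.one_ne_top, hQ⟩)
    ((lintegral_enorm_le_one_add _).trans ?_)
  gcongr

/-- Compactness. The bound for the integrals over arcs takes the place of a bound for the values
on the pieces: on pieces of length bounded below it implies such a bound, and on collapsing pieces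
it shows that the mass tends to zero, even if the values are unbounded. -/
theorem IsPiecewise.exists_subseq_tendsto {p : ℕ} {τ c : ℕ → ℕ → ℝ} {g u : ℕ → Circ → ℝ}
    {Q α : ℝ≥0∞} {M s : ℝ} (h : ∀ n, IsPiecewise p (τ n) (c n) (g n) (u n))
    (hone : ∀ n j, p + 1 ≤ j → τ n j = 1) (hQ : Q ≠ ⊤) (hgQ : ∀ n, ∫⁻ t, ‖g n t‖ₑ ^ 2 ≤ Q)
    (hα : Tendsto (fun n => ∫⁻ t, ‖g n t‖ₑ ^ 2) atTop (𝓝 α)) (hs : s < 1 / 2) (hM : 0 ≤ M)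
    (hu : ∀ n a b, 0 ≤ a → a ≤ b → b ≤ 1 →
      |∫ x in a..b, u n (x : Circ)| ≤ M * modulus s (b - a)) :
    ∃ (φ : ℕ → ℕ) (τ' c' : ℕ → ℝ) (g' v : Circ → ℝ), StrictMono φ ∧ IsPiecewise p τ' c' g' v ∧
      Measurable v ∧ ∫⁻ t, ‖g' t‖ₑ ^ 2 ≤ α ∧
      Tendsto (fun n => ∫⁻ t, ‖u (φ n) t - v t‖ₑ) atTop (𝓝 0) := by
  classical
  have hαtop : α ≠ ⊤ := ne_top_of_le_ne_top hQ (le_of_tendsto' hα hgQ)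
  set L := (1 + Q).toReal with hLdef
  have hL0 : 0 ≤ L := ENNReal.toReal_nonneg
  have hL : ∀ n, ∫ t, |g n t| ≤ L := fun n => (h n).integral_abs_le hQ (hgQ n)
  obtain ⟨W, hW⟩ := exists_modulus_le hs
  -- convergence of the nodes
  obtain ⟨τ', -, φ₁, hφ₁, hτ'⟩ := (isCompact_univ_pi fun _ : ℕ =>
    isCompact_Icc (a := (0 : ℝ)) (b := 1)).tendsto_subseq (x := τ) fun n => by
      refine mem_univ_pi.2 fun j => ?_
      rcases le_total j (p + 1) with hj | hj
      · exact (h n).mem_Icc hj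
      · rw [hone n j hj]; simp
  rw [tendsto_pi_nhds] at hτ'
  -- weak convergence of the gradients
  have hgm : ∀ n, MemLp (g n) 2 volume := fun n =>
    memLp_two_of_lintegral (h n).int.1 (ne_top_of_le_ne_top hQ (hgQ n))
  set G : ℕ → LpCirc 2 := fun n => (hgm n).toLp with hG
  have hGae : ∀ n, G n =ᵐ[volume] g n := fun n => (hgm n).coeFn_toLp
  have hGsq : ∀ n, ‖G n‖ ^ 2 = (∫⁻ t, ‖g n t‖ₑ ^ 2).toReal := by
    intro n
    have : ∫⁻ t, ‖g n t‖ₑ ^ 2 = ∫⁻ t, ‖G n t‖ₑ ^ 2 :=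
      lintegral_congr_ae (by filter_upwards [hGae n] with t ht; rw [ht])
    rw [this, lintegral_sq_enorm, ENNReal.toReal_ofReal (sq_nonneg _)]
  have hGnorm : ∀ n, ‖G n‖ = √(∫⁻ t, ‖g n t‖ₑ ^ 2).toReal := fun n => by
    rw [← hGsq, Real.sqrt_sq (norm_nonneg _)]
  have : Fact ((2 : ℝ≥0∞) ≠ ⊤) := ⟨by norm_num⟩
  obtain ⟨G', φ₂, hφ₂, hG'⟩ := exists_subseq_tendsto_inner (x := fun n => G (φ₁ n))
    (K := √Q.toReal) fun n => by
      rw [hGnorm]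
      exact Real.sqrt_le_sqrt (ENNReal.toReal_mono hQ (hgQ _))
  have hφ₁₂ : StrictMono fun n => φ₁ (φ₂ n) := hφ₁.comp hφ₂
  have hG'α : ∫⁻ t, ‖G' t‖ₑ ^ 2 ≤ α := by
    have hle : ‖G'‖ ≤ √α.toReal := by
      refine norm_le_of_tendsto_inner (hG' G') ?_
      simp_rw [hGnorm]
      exact (Real.continuous_sqrt.tendsto _).comp
        ((ENNReal.tendsto_toReal hαtop).comp (hα.comp hφ₁₂.tendsto_atTop))
    rw [lintegral_sq_enorm]
    refine ENNReal.ofReal_le_of_le_toReal ?_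
    calc ‖G'‖ ^ 2 ≤ √α.toReal ^ 2 := by gcongr
      _ = α.toReal := Real.sq_sqrt ENNReal.toReal_nonneg
  have hprim : ∀ x ∈ Icc (0 : ℝ) 1,
      Tendsto (fun n => prim (g (φ₁ (φ₂ n))) x) atTop (𝓝 (prim G' x)) := by
    intro x hx
    rw [← inner_arc_eq_prim G' hx]
    refine (hG' _).congr fun n => ?_
    rw [inner_arc_eq_prim _ hx, prim, prim, ← setIntegral_rep_le hx, ← setIntegral_rep_le hx]
    exact integral_congr_ae (ae_restrict_of_ae (hGae _))
  have hG'int : Integrable G' := (Lp.memLp G').integrable (by norm_num)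
  have hτ₂ : ∀ j, Tendsto (fun n => τ (φ₁ (φ₂ n)) j) atTop (𝓝 (τ' j)) := fun j =>
    (hτ' j).comp hφ₂.tendsto_atTop
  -- bounds for the values on the pieces
  have hcb : ∀ n, ∀ j ≤ p, |c n j| * (τ n (j + 1) - τ n j) ≤
      M * modulus s (τ n (j + 1) - τ n j) + L * (τ n (j + 1) - τ n j) := by
    intro n j hj
    have h0 := (h n).mem_Icc (j := j) (by omega)
    have h1 := (h n).mem_Icc (j := j + 1) (by omega)
    exact (h n).abs_mul_le (hL n) hj (hu n _ _ h0.1 ((h n).mono (Nat.le_succ j)) h1.2)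
  set d : ℕ → ℕ → ℝ := fun n j => if j ≤ p ∧ τ' j < τ' (j + 1) then c (φ₁ (φ₂ n)) j else 0 with hd
  -- for collapsing pieces `B j = 0` by the convention on division by zero, and `d n j = 0`
  set B : ℕ → ℝ := fun j => |(M * W + L) / ((τ' (j + 1) - τ' j) / 2)| with hB
  have hdB : ∀ᶠ n in atTop, d n ∈ univ.pi fun j => Icc (-B j) (B j) := by
    have hev : ∀ᶠ n in atTop, ∀ j ∈ Finset.range (p + 1), |d n j| ≤ B j := by
      rw [Filter.eventually_all_finset]
      intro j hj
      have hj' : j ≤ p := by have := Finset.mem_range.1 hj; omega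
      by_cases hlt : τ' j < τ' (j + 1)
      · have hpos : 0 < (τ' (j + 1) - τ' j) / 2 := by linarith
        filter_upwards [((hτ₂ (j + 1)).sub (hτ₂ j)).eventually_const_lt
          (show (τ' (j + 1) - τ' j) / 2 < τ' (j + 1) - τ' j by linarith)] with n hn
        simp only [hd, if_pos (And.intro hj' hlt), hB]
        refine le_trans ?_ (le_abs_self _)
        rw [le_div_iff₀ hpos]
        have h0 := (h (φ₁ (φ₂ n))).mem_Icc (j := j) (by omega)
        have h1 := (h (φ₁ (φ₂ n))).mem_Icc (j := j + 1) (by omega)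
        calc |c (φ₁ (φ₂ n)) j| * ((τ' (j + 1) - τ' j) / 2)
            ≤ |c (φ₁ (φ₂ n)) j| * (τ (φ₁ (φ₂ n)) (j + 1) - τ (φ₁ (φ₂ n)) j) := by
              gcongr
          _ ≤ _ := hcb _ j hj'
          _ ≤ M * W + L := by
              refine add_le_add (mul_le_mul_of_nonneg_left (hW _) hM) ?_
              exact mul_le_of_le_one_right hL0 (by linarith [h0.1, h1.2])
      · refine Eventually.of_forall fun n => ?_
        simp [hd, hlt, hB]
    filter_upwards [hev] with n hn
    refine mem_univ_pi.2 fun j => abs_le.1 ?_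
    by_cases hj : j ≤ p
    · exact hn j (Finset.mem_range.2 (by omega))
    · simp [hd, hj, hB]
  obtain ⟨c', -, φ₃, hφ₃, hc'⟩ := (isCompact_univ_pi fun j : ℕ =>
    isCompact_Icc (a := -B j) (b := B j)).tendsto_subseq' hdB.frequently
  rw [tendsto_pi_nhds] at hc'
  have hφ : StrictMono fun n => φ₁ (φ₂ (φ₃ n)) := hφ₁₂.comp hφ₃
  have hτ₃ : ∀ j, Tendsto (fun n => τ (φ₁ (φ₂ (φ₃ n))) j) atTop (𝓝 (τ' j)) := fun j =>
    (hτ₂ j).comp hφ₃.tendsto_atTop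
  have hcc : ∀ j ≤ p, τ' j < τ' (j + 1) →
      Tendsto (fun n => c (φ₁ (φ₂ (φ₃ n))) j) atTop (𝓝 (c' j)) := by
    intro j hj hlt
    refine (hc' j).congr fun n => ?_
    simp only [Function.comp_apply, hd, if_pos (And.intro hj hlt)]
  have hcol : ∀ j ≤ p, τ' j = τ' (j + 1) → Tendsto (fun n => |c (φ₁ (φ₂ (φ₃ n))) j| *
      (τ (φ₁ (φ₂ (φ₃ n))) (j + 1) - τ (φ₁ (φ₂ (φ₃ n))) j)) atTop (𝓝 0) := by
    intro j hj heq
    have hlen : Tendsto (fun n => τ (φ₁ (φ₂ (φ₃ n))) (j + 1) - τ (φ₁ (φ₂ (φ₃ n))) j) atTop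
        (𝓝 0) := by
      have := (hτ₃ (j + 1)).sub (hτ₃ j)
      rwa [heq, sub_self] at this
    have hub := (((tendsto_modulus hs).comp hlen).const_mul M).add (hlen.const_mul L)
    simp only [mul_zero, add_zero] at hub
    refine tendsto_of_tendsto_of_tendsto_of_le_of_le tendsto_const_nhds hub (fun n => ?_)
      fun n => hcb _ j hj
    exact mul_nonneg (abs_nonneg _) (sub_nonneg.2 ((h _).mono (Nat.le_succ j)))
  obtain ⟨v, hv, hvm, hlim⟩ := IsPiecewise.exists_of_tendsto
    (fun n => h (φ₁ (φ₂ (φ₃ n)))) hτ₃ hG'int (fun n => hL _)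
    (fun x hx => (hprim x hx).comp hφ₃.tendsto_atTop) hcc hcol
  exact ⟨_, τ', c', G', v, hφ, hv, hvm, hG'α, hlim⟩

/-! ### The residual -/

lemma sobolevNorm_congr_ae {u v : Circ → ℝ} (h : u =ᵐ[volume] v) (r : ℝ) :
    sobolevNorm r u = sobolevNorm r v := by
  rw [volume_eq_haarAddCircle] at h
  have : ∀ k, fourierCoeff (T := (1 : ℝ)) (fun t => (u t : ℂ)) k =
      fourierCoeff (T := (1 : ℝ)) (fun t => (v t : ℂ)) k := fun k =>
    integral_congr_ae (by filter_upwards [h] with t ht; rw [ht])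
  simp only [sobolevNorm, this]

lemma eLpNorm_sub_le_residual (A : LpCirc 1 → LpCirc 1) (m : LpCirc 2) (w : LpCirc 1) :
    eLpNorm (fun t => A w t - m t) 2 volume ≤ residual A m w ^ (1 / 2 : ℝ) := by
  unfold residual
  split_ifs with h
  · rw [← ENNReal.rpow_natCast, ← ENNReal.rpow_mul]
    norm_num
  · rw [ENNReal.top_rpow_of_pos (by norm_num)]
    exact le_top

lemma IsPiecewise.memLp {p : ℕ} {τ c : ℕ → ℝ} {g u : Circ → ℝ} (h : IsPiecewise p τ c g u)
    (hu : AEStronglyMeasurable u volume) (q : ℝ≥0∞) : MemLp u q volume := by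
  obtain ⟨k, hk⟩ := h.ae_abs_le
  exact MemLp.of_bound hu k (by simpa only [Real.norm_eq_abs] using hk)

/-- A bound for the residual controls the integrals over arcs: it bounds `A w` in `L²(𝕋)`, hence
`w` in `H^{-s}(𝕋)`. -/
lemma IsPiecewise.abs_integral_le_of_residual_le {A : LpCirc 1 →L[ℝ] LpCirc 1}
    {A₂ : LpCirc 2 →L[ℝ] LpCirc 2}
    (hA : ∀ (f : LpCirc 1) (g : LpCirc 2), f =ᵐ[volume] g → A f =ᵐ[volume] A₂ g)
    {s : ℝ} (hs : s < 1 / 2) {C : ℝ} (hC : 0 < C)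
    (hest : ∀ u : LpCirc 2, sobolevNorm (-s) u ≤ ENNReal.ofReal (C * ‖A₂ u‖)) {m : LpCirc 2}
    {w : LpCirc 1} {p : ℕ} {τ c : ℕ → ℝ} {g : Circ → ℝ} (h : IsPiecewise p τ c g w)
    {Q : ℝ≥0∞} (hQ : Q ≠ ⊤) (hres : residual A m w ≤ Q) {a b : ℝ} (ha : 0 ≤ a) (hab : a ≤ b)
    (hb : b ≤ 1) :
    |∫ x in a..b, w (x : Circ)| ≤ C * ((Q ^ (1 / 2 : ℝ)).toReal + ‖m‖) * modulus s (b - a) := by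
  have hw : MemLp w 2 volume := h.memLp (Lp.aestronglyMeasurable w) 2
  have hwae := hw.coeFn_toLp
  refine abs_integral_le_modulus hs hw (by positivity) ?_ ha hab hb
  rw [← sobolevNorm_congr_ae hwae]
  refine (hest _).trans (ENNReal.ofReal_le_ofReal (mul_le_mul_of_nonneg_left ?_ hC.le))
  have hAw := hA w hw.toLp hwae.symm
  calc ‖A₂ hw.toLp‖ ≤ ‖A₂ hw.toLp - m‖ + ‖m‖ := by
        simpa using norm_add_le (A₂ hw.toLp - m) m
    _ ≤ _ := by
        gcongr
        rw [Lp.norm_def]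
        refine ENNReal.toReal_mono (ENNReal.rpow_ne_top_of_nonneg (by norm_num) hQ) ?_
        calc eLpNorm (A₂ hw.toLp - m : LpCirc 2) 2 volume
            = eLpNorm (fun t => A w t - m t) 2 volume := by
              refine eLpNorm_congr_ae ?_
              filter_upwards [hAw, Lp.coeFn_sub (A₂ hw.toLp) m] with t h1 h2
              rw [h1, h2]; rfl
          _ ≤ residual A m w ^ (1 / 2 : ℝ) := eLpNorm_sub_le_residual _ _ _
          _ ≤ _ := by gcongr

/-- The residual is lower semicontinuous on `L¹(𝕋)`: as `A` is continuous there, this is Fatou's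
lemma along an almost everywhere convergent subsequence. -/
lemma residual_le_of_tendsto (A : LpCirc 1 →L[ℝ] LpCirc 1) (m : LpCirc 2) {w : ℕ → LpCirc 1}
    {u : LpCirc 1} (hw : Tendsto w atTop (𝓝 u)) {β : ℝ≥0∞}
    (hβ : Tendsto (fun n => residual A m (w n)) atTop (𝓝 β)) : residual A m u ≤ β := by
  rcases eq_or_ne β ⊤ with rfl | hβtop
  · exact le_top
  obtain ⟨φ, hφ, hae⟩ := (tendstoInMeasure_of_tendsto_Lp
    ((A.continuous.tendsto u).comp hw)).exists_seq_tendsto_ae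
  have hm : AEStronglyMeasurable (fun t => A u t - m t) volume :=
    (Lp.aestronglyMeasurable _).sub (Lp.aestronglyMeasurable _)
  have hle : eLpNorm (fun t => A u t - m t) 2 volume ≤ β ^ (1 / 2 : ℝ) := by
    have hlim : Tendsto (fun n => residual A m (w (φ n)) ^ (1 / 2 : ℝ)) atTop
        (𝓝 (β ^ (1 / 2 : ℝ))) :=
      ((ENNReal.continuous_rpow_const (y := (1 / 2 : ℝ))).tendsto β).comp
        (hβ.comp hφ.tendsto_atTop)
    rw [← hlim.liminf_eq]
    refine (Lp.eLpNorm_lim_le_liminf_eLpNorm (f := fun n t => A (w (φ n)) t - m t)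
      (fun n => (Lp.aestronglyMeasurable _).sub (Lp.aestronglyMeasurable _)) _ ?_).trans
      (liminf_le_liminf (Eventually.of_forall fun n => eLpNorm_sub_le_residual _ _ _))
    filter_upwards [hae] with t ht
    exact ht.sub_const _
  have hmem : MemLp (A u) 2 volume := by
    have h1 : MemLp (fun t => A u t - m t) 2 volume :=
      ⟨hm, hle.trans_lt (lt_top_iff_ne_top.2 (ENNReal.rpow_ne_top_of_nonneg (by norm_num) hβtop))⟩
    have h2 := h1.add (Lp.memLp m)
    refine h2.ae_eq (Eventually.of_forall fun t => ?_)
    simp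
  rw [residual, if_pos hmem]
  calc _ ≤ (β ^ (1 / 2 : ℝ)) ^ 2 := by gcongr
    _ = β := by rw [← ENNReal.rpow_natCast, ← ENNReal.rpow_mul]; norm_num

/-! ### Existence of minimizers -/

lemma MS_zero_add_residual_zero_ne_top (A : LpCirc 1 →L[ℝ] LpCirc 1) (m : LpCirc 2) :
    MS (0 : LpCirc 1) (fun _ => 1) + residual A m 0 ≠ ⊤ := by
  have hpw : IsPiecewise 0 (fun j => if j = 0 then 0 else 1) 0 0 (fun _ => 0) :=
    { mono := monotone_nat_of_le_succ fun n => by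
        simp only [Nat.add_eq_zero_iff, one_ne_zero, and_false, if_false]
        split_ifs <;> norm_num
      zero := rfl
      last := rfl
      int := integrable_zero _ _ _
      eq := fun j _ => Eventually.of_forall fun x _ => by simp [prim]
      glue := fun _ => by simp [prim] }
  have hpw' := hpw.congr_ae (v := (0 : LpCirc 1)) (Lp.coeFn_zero ℝ 1 volume).symm
  refine ENNReal.add_ne_top.2
    ⟨ne_top_of_le_ne_top ?_ (hpw'.MS_le (Lp.stronglyMeasurable _).measurable), ?_⟩
  · simp
  · have h0 : ⇑(A 0) =ᵐ[volume] fun _ => (0 : ℝ) := by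
      rw [map_zero]; exact Lp.coeFn_zero ℝ 1 volume
    have hmem : MemLp (A 0) 2 volume := (MemLp.zero' (p := 2)).ae_eq h0.symm
    rw [residual, if_pos hmem]
    exact ENNReal.pow_ne_top (hmem.sub (Lp.memLp m)).2.ne

/-- If the energies of a sequence are bounded and converge to `I`, then the limit of a subsequence
has energy at most `I`. -/
theorem exists_le_of_tendsto {A : LpCirc 1 →L[ℝ] LpCirc 1} {A₂ : LpCirc 2 →L[ℝ] LpCirc 2}
    (hA : ∀ (f : LpCirc 1) (g : LpCirc 2), f =ᵐ[volume] g → A f =ᵐ[volume] A₂ g)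
    {s : ℝ} (hs : s < 1 / 2) {C : ℝ} (hC : 0 < C)
    (hest : ∀ u : LpCirc 2, sobolevNorm (-s) u ≤ ENNReal.ofReal (C * ‖A₂ u‖)) (m : LpCirc 2)
    {w : ℕ → LpCirc 1} {I Q : ℝ≥0∞} (hQ : Q ≠ ⊤)
    (hwQ : ∀ n, MS (w n) (fun _ => 1) + residual A m (w n) ≤ Q)
    (hw : Tendsto (fun n => MS (w n) (fun _ => 1) + residual A m (w n)) atTop (𝓝 I)) :
    ∃ u : LpCirc 1, IsGSBV u ∧ MS u (fun _ => 1) + residual A m u ≤ I := by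
  have hMSQ : ∀ n, MS (w n) (fun _ => 1) ≤ Q := fun n => le_self_add.trans (hwQ n)
  have hRQ : ∀ n, residual A m (w n) ≤ Q := fun n => le_add_self.trans (hwQ n)
  choose p τ c g hpw hone _ hMS using fun n =>
    exists_isPiecewise_of_MS_ne_top (ne_top_of_le_ne_top hQ (hMSQ n))
  -- a subsequence with a constant number of pieces
  obtain ⟨N, hN⟩ := ENNReal.exists_nat_gt hQ
  have hpN : ∀ n, ∃ q ∈ Finset.range N, p n = q := fun n => by
    refine ⟨p n, Finset.mem_range.2 ?_, rfl⟩
    have : (p n : ℝ≥0∞) < N := lt_of_le_of_lt ((le_add_self.trans (hMS n).ge).trans (hMSQ n)) hN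
    exact_mod_cast this
  obtain ⟨q, -, hq⟩ := (Filter.frequently_exists_finset (Finset.range N)).1
    (Eventually.of_forall hpN : ∀ᶠ n in atTop, ∃ q ∈ Finset.range N, p n = q).frequently
  obtain ⟨φ₁, hφ₁, hpq⟩ := Filter.extraction_of_frequently_atTop hq
  -- a subsequence along which both parts of the energy converge
  obtain ⟨⟨α, β⟩, φ₂, hφ₂, hαβ⟩ := CompactSpace.tendsto_subseq
    fun n => ((∫⁻ t, ‖g (φ₁ n) t‖ₑ ^ 2, residual A m (w (φ₁ n))) : ℝ≥0∞ × ℝ≥0∞)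
  rw [Prod.tendsto_iff] at hαβ
  obtain ⟨hα, hβ⟩ := hαβ
  have hφ₁₂ : StrictMono fun n => φ₁ (φ₂ n) := hφ₁.comp hφ₂
  have hgQ : ∀ n, ∫⁻ t, ‖g n t‖ₑ ^ 2 ≤ Q := fun n =>
    (le_self_add.trans (hMS n).ge).trans (hMSQ n)
  obtain ⟨φ₃, τ', c', g', v, hφ₃, hv, hvm, hgα, hlim⟩ := IsPiecewise.exists_subseq_tendsto
    (p := q) (u := fun n => w (φ₁ (φ₂ n))) (s := s)
    (M := C * ((Q ^ (1 / 2 : ℝ)).toReal + ‖m‖))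
    (fun n => hpq (φ₂ n) ▸ hpw (φ₁ (φ₂ n)))
    (fun n j hj => hone (φ₁ (φ₂ n)) j (by rw [hpq]; exact hj))
    hQ (fun n => hgQ _) hα hs (by positivity)
    (fun n a b ha hab hb =>
      (hpw _).abs_integral_le_of_residual_le hA hs hC hest hQ (hRQ _) ha hab hb)
  have hvL : MemLp v 1 volume := hv.memLp hvm.aestronglyMeasurable 1
  have hvae := hvL.coeFn_toLp
  set u : LpCirc 1 := hvL.toLp
  have hu := hv.congr_ae hvae.symm
  have hum : Measurable u := (Lp.stronglyMeasurable u).measurable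
  have hwu : Tendsto (fun n => w (φ₁ (φ₂ (φ₃ n)))) atTop (𝓝 u) := by
    rw [Lp.tendsto_Lp_iff_tendsto_eLpNorm']
    refine hlim.congr fun n => ?_
    rw [eLpNorm_one_eq_lintegral_enorm]
    refine lintegral_congr_ae ?_
    filter_upwards [hvae] with t ht
    rw [Pi.sub_apply, ht]
  have hsum : α + q + β = I := by
    have h1 := (hα.add_const (q : ℝ≥0∞)).add hβ
    refine tendsto_nhds_unique h1 ((hw.comp hφ₁₂.tendsto_atTop).congr fun n => ?_)
    simp only [Function.comp_apply, hMS, hpq]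
  refine ⟨u, hu.isGSBV hum, ?_⟩
  rw [← hsum]
  refine add_le_add ((hu.MS_le hum).trans (by gcongr)) ?_
  exact residual_le_of_tendsto A m hwu (hβ.comp hφ₃.tendsto_atTop)

end MumfordShah

end

theorem mainTheorem2
    (A : MumfordShah.LpCirc 1 →L[ℝ] MumfordShah.LpCirc 1)
    (A₂ : MumfordShah.LpCirc 2 →L[ℝ] MumfordShah.LpCirc 2)
    (hA : ∀ (f : MumfordShah.LpCirc 1) (g : MumfordShah.LpCirc 2),
      f =ᵐ[volume] g → A f =ᵐ[volume] A₂ g)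
    (s : ℝ) (hs : s < 1 / 2) (C : ℝ) (hC : 0 < C)
    (hest : ∀ u : MumfordShah.LpCirc 2,
      MumfordShah.sobolevNorm (-s) u ≤ ENNReal.ofReal (C * ‖A₂ u‖))
    (m : MumfordShah.LpCirc 2) :
    ∃ u : MumfordShah.LpCirc 1, MumfordShah.IsGSBV u ∧
      MumfordShah.MS u (fun _ => 1) + MumfordShah.residual A m u =
        ⨅ w : MumfordShah.LpCirc 1,
          (MumfordShah.MS w (fun _ => 1) + MumfordShah.residual A m w) := by
  set I : ℝ≥0∞ := ⨅ w : MumfordShah.LpCirc 1,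
    (MumfordShah.MS w (fun _ => 1) + MumfordShah.residual A m w)
  have hI : I ≠ ⊤ := ne_top_of_le_ne_top (MumfordShah.MS_zero_add_residual_zero_ne_top A m)
    (iInf_le _ 0)
  have hex : ∀ n : ℕ, ∃ w : MumfordShah.LpCirc 1,
      MumfordShah.MS w (fun _ => 1) + MumfordShah.residual A m w < I + ((n + 1 : ℕ) : ℝ≥0∞)⁻¹ :=
    fun n => iInf_lt_iff.1 (ENNReal.lt_add_right hI (by simp))
  choose w hw using hex
  have hlim : Tendsto (fun n => MumfordShah.MS (w n) (fun _ => 1) +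
      MumfordShah.residual A m (w n)) atTop (𝓝 I) := by
    have h := (ENNReal.tendsto_inv_nat_nhds_zero.comp (tendsto_add_atTop_nat 1)).const_add I
    rw [add_zero] at h
    exact tendsto_of_tendsto_of_tendsto_of_le_of_le tendsto_const_nhds h (fun n => iInf_le _ (w n))
      fun n => (hw n).le
  obtain ⟨u, hu, hle⟩ := MumfordShah.exists_le_of_tendsto hA hs hC hest m (Q := I + 1)
    (ENNReal.add_ne_top.2 ⟨hI, ENNReal.one_ne_top⟩)
    (fun n => (hw n).le.trans (by gcongr; simp)) hlim
  exact ⟨u, hu, le_antisymm hle (iInf_le _ u)⟩
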